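/- **Setting.** Let $\mathcal G$ be a connected, undirected, unweighted graph on $M\ge 2$ nodes with diameter $D$; let $d_i$ be the degrees, $P=\mathrm{diag}(d_1,\dots,d_M)$, and let $F\in\mathbb R^{E\times M}$ be the oriented incidence matrix: for an edge $e=(i,j)$ with $i>j$, $F_{ei}=1$, $F_{ej}=-1$ and the other entries of row $e$ are $0$. Put $A=FP^{-1/2}$ and $\mathcal L=A^{T}A$ (the normalized graph Laplacian). For a symmetric matrix $B$ let $\underline\lambda_{\min}(B)$ be its smallest nonzero eigenvalue, $\lambda_{\max}(B)$ its largest eigenvalue and $\xi(B)=\underline\lambda_{\min}(B)/\lambda_{\max}(B)$. *Problems.* A problem consists of an $S\in\mathbb N$ and differentiable functions $f_i:\mathbb R^S\to\mathbb R$ $(1\le i\le M)$ whose gradients are Lipschitz continuous, with smallest Lipschitz constants $L_i\ge 0$, such that $f(x)=\frac1M\sum_{i=1}^M f_i(x_i)$ is bounded below over $x=(x_1,\dots,x_M)\in\mathbb R^{MS}$. Put $\bar L=\frac1M\sum_i L_i$, $L=\mathrm{diag}(L_1,\dots,L_M)$, let $K$ be the diagonal $E\times E$ matrix with entry $\sqrt{L_iL_j}$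 at the edge $(i,j)$, and $$\widehat{\mathcal L}=L^{-1/2}F^{T}KFL^{-1/2},\qquad d_0=(\nabla f_1(0),\dots,\nabla f_M(0)),\qquad \|d_0\|_{L^{-1}}^2=\sum_{i=1}^M L_i^{-1}\|\nabla f_i(0)\|^2,$$ where inverses are Moore–Penrose pseudoinverses ($0^{-1}=0$). *Algorithms.* A linear distributed first-order algorithm prescribes, for every dimension $S$ and all Lipschitz constants $(L_i)$ but independently of the functions $f_i$, linear operators $Q_i^t:\mathbb R^S\to\mathbb R^S$ (communication) and linear operators $W_i^t$ (computation). It starts at $x_i^0=0$; node $i$ broadcasts $v_i^t=Q_i^t(x_i^t)$ to its neighbours, and $$x_i^{t+1}\in W_i^t\big(\{\{v_j^k\}_{j\sim i},\ \nabla f_i(x_i^k),\ x_i^k\}_{k=0}^{t}\big),$$ where the right-hand side is the set of all linear combinations, with arbitrary (possibly adaptively chosen) real coefficients, of the images of the individual data under the corresponding blocks of $W_i^t$. (If all blocks are the identity, this is the linear span of the data; the value of the linear operator $W_i^t$ at the data always belongs to it.) *Accuracy.* With every edge counted once, $$h_t^*=\min_{0\le s\le t}\ \Big\|\frac1M\sum_{i=1}^M\nabla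 f_i(x_i^s)\Big\|^2+\frac{1}{M\,\underline\lambda_{\min}(P^{1/2}\mathcal L P^{1/2})}\sum_{(i,j):\,i\sim j}\sqrt{L_iL_j}\,\|x_i^s-x_j^s\|^2 .$$ **Corollary 3.2.** Let $\epsilon>0$. For any such network, any such algorithm and any $N\in\mathbb N$ there is a problem such that 1. its local Lipschitz constants reduce the effective network to a path: there are a shortest path of length $D$ in $\mathcal G$ (joining two nodes at distance $D$) and an $\ell>0$ such that $L_i=\ell$ for the nodes $i$ on this path and $L_i=0$ for all other nodes; 2. $\displaystyle \left\lfloor\Big(f(0)-\inf_x f(x)+\frac{\|d_0\|^2_{L^{-1}}}{M}\Big)\frac{\bar L}{1650\pi^2}\,\epsilon^{-1}\right\rfloor\ge N$; 3. for every sequence of iterates that the algorithm may generate on this problem, $h_t^*<\epsilon$ implies $$t\ \ge\ \frac{1}{3\sqrt{\xi(\widehat{\mathcal L})}}\left\lfloor\Big(f(0)-\inf_x f(x)+\frac{\|d_0\|^2_{L^{-1}}}{M}\Big)\frac{\bar L}{1650\pi^2}\,\epsilon^{-1}\right\rfloor .$$ -/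

import Mathlib

/-! ### Spectral quantities of real square matrices -/

/-- `λ_max(B)`: the largest eigenvalue of a symmetric real matrix. -/
noncomputable def lambdaMax {n : ℕ} (B : Matrix (Fin n) (Fin n) ℝ) : ℝ :=
  sSup (spectrum ℝ B)

/-- The smallest *nonzero* eigenvalue of a symmetric real matrix (underlined `λ_min(B)`). -/
noncomputable def lambdaMinPos {n : ℕ} (B : Matrix (Fin n) (Fin n) ℝ) : ℝ :=
  sInf {μ | μ ∈ spectrum ℝ B ∧ μ ≠ 0}

/-- The spectral gap `ξ(B)`: smallest nonzero eigenvalue over largest eigenvalue. -/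
noncomputable def spectralGap {n : ℕ} (B : Matrix (Fin n) (Fin n) ℝ) : ℝ :=
  lambdaMinPos B / lambdaMax B

/-! ### Graph matrices -/

/-- Every undirected edge of `G`, listed exactly once as a pair `(i, j)` with `i > j`. -/
abbrev GraphEdge {M : ℕ} (G : SimpleGraph (Fin M)) : Type :=
  {p : Fin M × Fin M // p.2 < p.1 ∧ G.Adj p.1 p.2}

noncomputable instance {M : ℕ} (G : SimpleGraph (Fin M)) : Fintype (GraphEdge G) :=
  Fintype.ofFinite _

noncomputable instance {M : ℕ} (G : SimpleGraph (Fin M)) : DecidableEq (GraphEdge G) :=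
  Classical.decEq _

open Classical in
/-- The degree `d_v` as a real number. -/
noncomputable def graphDeg {M : ℕ} (G : SimpleGraph (Fin M)) (v : Fin M) : ℝ :=
  (G.degree v : ℝ)

/-- `P^{1/2}`, where `P` is the diagonal matrix of degrees. -/
noncomputable def sqrtDegMatrix {M : ℕ} (G : SimpleGraph (Fin M)) :
    Matrix (Fin M) (Fin M) ℝ :=
  Matrix.diagonal fun v => Real.sqrt (graphDeg G v)

/-- The (normalized, oriented) incidence matrix `A`. -/
noncomputable def incidenceA {M : ℕ} (G : SimpleGraph (Fin M)) :
    Matrix (GraphEdge G) (Fin M) ℝ :=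
  Matrix.of fun e v =>
    if v = e.1.1 then 1 / Real.sqrt (graphDeg G v)
    else if v = e.1.2 then -(1 / Real.sqrt (graphDeg G v))
    else 0

/-- The graph Laplacian `𝓛 = Aᵀ A` (normalized). -/
noncomputable def graphLaplacian {M : ℕ} (G : SimpleGraph (Fin M)) :
    Matrix (Fin M) (Fin M) ℝ :=
  (incidenceA G).transpose * incidenceA G

/-- The scaled incidence matrix `F = A P^{1/2}`. -/
noncomputable def incidenceF {M : ℕ} (G : SimpleGraph (Fin M)) :
    Matrix (GraphEdge G) (Fin M) ℝ :=
  incidenceA G * sqrtDegMatrix G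

/-- The diagonal edge matrix `K` with entry `√(L_i L_j)` at the edge `(i, j)`. -/
noncomputable def edgeK {M : ℕ} (G : SimpleGraph (Fin M)) (L : Fin M → ℝ) :
    Matrix (GraphEdge G) (GraphEdge G) ℝ :=
  Matrix.diagonal fun e => Real.sqrt (L e.1.1 * L e.1.2)

/-- `L^{-1/2}` for `L = diag(L_1, …, L_M)`. As `0⁻¹ = 0` in Lean, this is the Moore–Penrose
pseudoinverse of `L^{1/2}` when some `L_i` vanish. -/
noncomputable def invSqrtL {M : ℕ} (L : Fin M → ℝ) : Matrix (Fin M) (Fin M) ℝ :=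
  Matrix.diagonal fun i => (Real.sqrt (L i))⁻¹

/-- The generalized Laplacian `L^{-1/2} Fᵀ K F L^{-1/2}`. -/
noncomputable def hatLaplacian {M : ℕ} (G : SimpleGraph (Fin M)) (L : Fin M → ℝ) :
    Matrix (Fin M) (Fin M) ℝ :=
  invSqrtL L * (incidenceF G).transpose * edgeK G L * incidenceF G * invSqrtL L

/-! ### The problem class -/

/-- A problem with `M` agents: component functions `f_i : ℝ^S → ℝ`, differentiable, whose gradients
have the *smallest* Lipschitz constants `L_i`, such that
`f(x) = (1/M) ∑ f_i(x_i)` is bounded below on `ℝ^{MS}`. -/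
structure DistProblem (M : ℕ) where
  /-- dimension of the variable of each agent -/
  S : ℕ
  /-- local functions -/
  f : Fin M → EuclideanSpace ℝ (Fin S) → ℝ
  /-- local Lipschitz constants -/
  L : Fin M → ℝ
  differentiable : ∀ i, Differentiable ℝ (f i)
  lipschitz : ∀ i, IsLeast
    {K : ℝ | 0 ≤ K ∧ ∀ x z, ‖gradient (f i) x - gradient (f i) z‖ ≤ K * ‖x - z‖} (L i)
  bddBelow : BddBelow (Set.range fun x : Fin M → EuclideanSpace ℝ (Fin S) =>
    (1 / (M : ℝ)) * ∑ i, f i (x i))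

namespace DistProblem

variable {M : ℕ}

/-- The separable objective `f(x) = (1/M) ∑ f_i(x_i)`. -/
noncomputable def obj (p : DistProblem M) (x : Fin M → EuclideanSpace ℝ (Fin p.S)) : ℝ :=
  (1 / (M : ℝ)) * ∑ i, p.f i (x i)

/-- The average Lipschitz constant. -/
noncomputable def avgL (p : DistProblem M) : ℝ := (1 / (M : ℝ)) * ∑ i, p.L i

/-- `‖d₀‖²_{L⁻¹} = d₀ᵀ L⁻¹ d₀` with `d₀ = (∇f_1(0), …, ∇f_M(0))`; `L⁻¹` is the pseudoinverse. -/
noncomputable def d0NormSq (p : DistProblem M) : ℝ :=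
  ∑ i, (p.L i)⁻¹ * ‖gradient (p.f i) 0‖ ^ 2

/-- The quantity
`‖(1/M) ∑ ∇f_i(x_i)‖² + (1/(M λ)) ∑_{i∼j} √(L_i L_j) ‖x_i - x_j‖²`, where `λ` is the smallest
nonzero eigenvalue of `P^{1/2} 𝓛 P^{1/2}` and every edge is counted once. -/
noncomputable def localGap (p : DistProblem M) (G : SimpleGraph (Fin M))
    (x : Fin M → EuclideanSpace ℝ (Fin p.S)) : ℝ :=
  ‖(1 / (M : ℝ)) • ∑ i, gradient (p.f i) (x i)‖ ^ 2
    + 1 / ((M : ℝ) * lambdaMinPos (sqrtDegMatrix G * graphLaplacian G * sqrtDegMatrix G))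
      * ∑ e : GraphEdge G, Real.sqrt (p.L e.1.1 * p.L e.1.2) * ‖x e.1.1 - x e.1.2‖ ^ 2

/-- `h*_t`: the best value of `localGap` among the iterates `x^0, …, x^t`. -/
noncomputable def hStar (p : DistProblem M) (G : SimpleGraph (Fin M))
    (x : ℕ → Fin M → EuclideanSpace ℝ (Fin p.S)) (t : ℕ) : ℝ :=
  (Finset.range (t + 1)).inf' Finset.nonempty_range_add_one fun s => p.localGap G (x s)

end DistProblem

/-! ### The algorithm class -/

/-- A linear distributed first-order algorithm for `M` agents. For every dimension `S` and all
Lipschitz constants `L` (so the operators may depend on those, but not on the functions `f_i`) it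
prescribes linear operators on `ℝ^S`:
* `Q S L t i`: the operator `Q_i^t` used by node `i` to form the broadcast `v_i^t = Q_i^t(x_i^t)`;
* `Wv S L t i k j`, `Wg S L t i k`, `Wx S L t i k`: the blocks of the computation operator `W_i^t`,
  acting on `v_j^k`, `∇f_i(x_i^k)`, `x_i^k`, respectively (for `k ≤ t`). -/
structure DistAlgorithm (M : ℕ) where
  Q : (S : ℕ) → (Fin M → ℝ) → ℕ → Fin M →
    (EuclideanSpace ℝ (Fin S) →ₗ[ℝ] EuclideanSpace ℝ (Fin S))
  Wv : (S : ℕ) → (Fin M → ℝ) → ℕ → Fin M → ℕ → Fin M →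
    (EuclideanSpace ℝ (Fin S) →ₗ[ℝ] EuclideanSpace ℝ (Fin S))
  Wg : (S : ℕ) → (Fin M → ℝ) → ℕ → Fin M → ℕ →
    (EuclideanSpace ℝ (Fin S) →ₗ[ℝ] EuclideanSpace ℝ (Fin S))
  Wx : (S : ℕ) → (Fin M → ℝ) → ℕ → Fin M → ℕ →
    (EuclideanSpace ℝ (Fin S) →ₗ[ℝ] EuclideanSpace ℝ (Fin S))

/-- `x` is a sequence of iterates that the algorithm may generate on the problem over the network,
started at `0`: the next iterate `x_i^{t+1}` is a linear combination, with arbitrary (possibly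
adaptively chosen) real coefficients, of what the blocks of `W_i^t` make out of the messages received
from neighbours, the own gradients and the own iterates up to time `t`.
If all operators are the identity, `x_i^{t+1}` is an arbitrary element of the linear span of that
data; with all coefficients `1`, it is the value of the linear operator `W_i^t` at that data. -/
def DistAlgorithm.IsRun {M : ℕ} (a : DistAlgorithm M) (G : SimpleGraph (Fin M))
    (p : DistProblem M) (x : ℕ → Fin M → EuclideanSpace ℝ (Fin p.S)) : Prop :=
  (∀ i, x 0 i = 0) ∧
  ∀ t i, x (t + 1) i ∈ Submodule.span ℝ
    ({z | ∃ k ≤ t, ∃ j, G.Adj i j ∧ z = a.Wv p.S p.L t i k j (a.Q p.S p.L k j (x k j))} ∪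
     {z | ∃ k ≤ t, z = a.Wg p.S p.L t i k (gradient (p.f i) (x k i))} ∪
     {z | ∃ k ≤ t, z = a.Wx p.S p.L t i k (x k i)})

/-! The hard functions are chains along orthonormal directions `u 0, u 1, …`. Link `k` joins
coordinate `k` to coordinate `k + 1`, where coordinate `0` is the constant `1`, and it cannot move a
vanishing coordinate `k + 1` while coordinate `k` vanishes. As long as the last coordinate is zero,
some link joins a coordinate `≥ 1` to one `< 1`, and its slope keeps the gradient at consensus away
from zero (`linkSnd_le_neg_one`, `IsGeodesic.le_norm_sum_chainGrad`).

On a path realizing the diameter, even links belong to the first third and odd links to the last;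
nodes off the path get the zero function. Releasing one more coordinate requires information to
cross the middle of the path, which costs at least `(D + 1) / 3` rounds per link
(`mem_reach_of_run`). Arbitrary linear operators do not help: they are fixed before `u` is chosen,
so in a large dimension each `u k` can be made orthogonal to everything they produce from the
earlier directions (`exists_orthonormal_out_of_reach`).

Two scales are free. The Lipschitz constant `l` is so small that a consensus error able to hide the
gradient is itself penalized by `ε`, and `σ` makes the averaged gradient at consensus at least `2
√ε` (`not_lt_of_scales`). The effective Laplacian is that of a path with `D + 1` nodes; its nonzero
eigenvalues lie in `[1 / (D + 1) ^ 2, 4]` (`IsGeodesic.eigenvalue_bounds`), so `1 / √ξ ≤ 2 (D + 1)`,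
comparable to the cost of a link. As the decrease of the objective is essentially proportional to
the number of links (`floor_arg_bounds`), the time bound follows. -/

/-! ### A piecewise quadratic step function -/

/-- Half the square of the positive part. -/
noncomputable def halfPosSq (x : ℝ) : ℝ := (max x 0) ^ 2 / 2

/-- The hat function of height `2` supported on `[0, 1]`. -/
noncomputable def hat (a : ℝ) : ℝ := max 0 (min (4 * a) (4 - 4 * a))

/-- The antiderivative of `hat`, rising from `0` to `1` on `[0, 1]`. -/
noncomputable def smoothStep (a : ℝ) : ℝ :=
  4 * halfPosSq a - 8 * halfPosSq (a - 1 / 2) + 4 * halfPosSq (a - 1)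

theorem hasDerivAt_halfPosSq (x : ℝ) : HasDerivAt halfPosSq (max x 0) x := by
  rcases lt_trichotomy x 0 with h | h | h
  · rw [max_eq_right h.le]
    refine (hasDerivAt_const x (0 : ℝ)).congr_of_eventuallyEq ?_
    filter_upwards [Iio_mem_nhds h] with y hy
    simp [halfPosSq, max_eq_right (le_of_lt (show y < 0 from hy))]
  · subst h
    rw [max_self, hasDerivAt_iff_isLittleO]
    have h1 : (fun x' : ℝ => x' ^ 2) =o[nhds 0] fun x' => x' := by
      simpa using Asymptotics.isLittleO_pow_pow (𝕜 := ℝ) (m := 1) (n := 2) (by norm_num)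
    have h2 : (fun x' : ℝ => halfPosSq x' - halfPosSq 0 - (x' - 0) • (0 : ℝ))
        =O[nhds 0] fun x' : ℝ => x' ^ 2 := by
      refine Asymptotics.IsBigO.of_bound 1 (Filter.Eventually.of_forall fun y => ?_)
      have h0 : halfPosSq y - halfPosSq 0 - (y - 0) • (0 : ℝ) = (max y 0) ^ 2 / 2 := by
        simp [halfPosSq]
      rw [h0, Real.norm_eq_abs, Real.norm_eq_abs]
      rw [abs_of_nonneg (by positivity), abs_of_nonneg (by positivity)]
      rcases le_total y 0 with hy | hy
      · rw [max_eq_right hy]; nlinarith [sq_nonneg y]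
      · rw [max_eq_left hy]; nlinarith [sq_nonneg y]
    simpa using h2.trans_isLittleO h1
  · rw [max_eq_left h.le]
    have : HasDerivAt (fun y : ℝ => y ^ 2 / 2) x x := by
      simpa using ((hasDerivAt_id x).pow 2).div_const 2
    refine this.congr_of_eventuallyEq ?_
    filter_upwards [Ioi_mem_nhds h] with y hy
    simp [halfPosSq, max_eq_left (le_of_lt (show 0 < y from hy))]

theorem halfPosSq_nonneg (x : ℝ) : 0 ≤ halfPosSq x := by unfold halfPosSq; positivity

theorem halfPosSq_of_nonpos {x : ℝ} (h : x ≤ 0) : halfPosSq x = 0 := by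
  simp [halfPosSq, max_eq_right h]

theorem halfPosSq_of_nonneg {x : ℝ} (h : 0 ≤ x) : halfPosSq x = x ^ 2 / 2 := by
  simp [halfPosSq, max_eq_left h]

/-- The right-hand side is the termwise derivative of `smoothStep`. -/
theorem hat_eq (a : ℝ) :
    hat a = 4 * max a 0 - 8 * max (a - 1 / 2) 0 + 4 * max (a - 1) 0 := by
  unfold hat
  simp only [max_def, min_def]
  split_ifs <;> linarith

theorem hasDerivAt_smoothStep (a : ℝ) : HasDerivAt smoothStep (hat a) a := by
  rw [hat_eq]
  have h1 := (hasDerivAt_halfPosSq a).const_mul 4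
  have h2 := ((hasDerivAt_halfPosSq (a - 1 / 2)).comp_sub_const a (1 / 2)).const_mul 8
  have h3 := ((hasDerivAt_halfPosSq (a - 1)).comp_sub_const a 1).const_mul 4
  exact (h1.sub h2).add h3

theorem hat_nonneg (a : ℝ) : 0 ≤ hat a := le_max_left _ _

theorem hat_le_two (a : ℝ) : hat a ≤ 2 := by
  refine max_le (by norm_num) ?_
  rcases le_total a (1 / 2) with h | h
  · exact (min_le_left _ _).trans (by linarith)
  · exact (min_le_right _ _).trans (by linarith)

theorem hat_zero : hat 0 = 0 := by simp [hat]

theorem one_le_hat {a : ℝ} (h1 : 1 / 4 ≤ a) (h2 : a ≤ 3 / 4) : 1 ≤ hat a :=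
  le_max_of_le_right (le_min (by linarith) (by linarith))

theorem abs_hat_sub_le (a b : ℝ) : |hat a - hat b| ≤ 4 * |a - b| := by
  unfold hat
  calc |max 0 (min (4 * a) (4 - 4 * a)) - max 0 (min (4 * b) (4 - 4 * b))|
      ≤ max |(0 : ℝ) - 0| |min (4 * a) (4 - 4 * a) - min (4 * b) (4 - 4 * b)| :=
        abs_max_sub_max_le_max _ _ _ _
    _ ≤ max 0 (max |4 * a - 4 * b| |(4 - 4 * a) - (4 - 4 * b)|) := by
        refine max_le_max (by simp) (abs_min_sub_min_le_max _ _ _ _)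
    _ = 4 * |a - b| := by
        have h1 : |4 * a - 4 * b| = 4 * |a - b| := by
          rw [← mul_sub, abs_mul]; norm_num
        have h2 : |(4 - 4 * a) - (4 - 4 * b)| = 4 * |a - b| := by
          rw [← h1, ← abs_neg]; congr 1; ring
        rw [h1, h2, max_self, max_eq_right (by positivity)]

theorem abs_smoothStep_sub_le (a b : ℝ) : |smoothStep a - smoothStep b| ≤ 2 * |a - b| := by
  have := Convex.norm_image_sub_le_of_norm_hasDerivWithin_le (f := smoothStep) (f' := hat)
    (s := Set.univ) (x := b) (y := a) (C := 2)
    (fun x _ => (hasDerivAt_smoothStep x).hasDerivWithinAt)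
    (fun x _ => by rw [Real.norm_eq_abs, abs_of_nonneg (hat_nonneg x)]; exact hat_le_two x)
    convex_univ trivial trivial
  simpa using this

theorem smoothStep_of_nonpos {a : ℝ} (h : a ≤ 0) : smoothStep a = 0 := by
  simp only [smoothStep]
  rw [halfPosSq_of_nonpos h, halfPosSq_of_nonpos (by linarith), halfPosSq_of_nonpos (by linarith)]
  ring

theorem smoothStep_zero : smoothStep 0 = 0 := smoothStep_of_nonpos le_rfl

theorem smoothStep_of_one_le {a : ℝ} (h : 1 ≤ a) : smoothStep a = 1 := by
  simp only [smoothStep]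
  rw [halfPosSq_of_nonneg (by linarith), halfPosSq_of_nonneg (by linarith),
    halfPosSq_of_nonneg (by linarith)]
  ring

theorem smoothStep_monotone : Monotone smoothStep :=
  monotone_of_hasDerivAt_nonneg hasDerivAt_smoothStep hat_nonneg

theorem smoothStep_half : smoothStep (1 / 2) = 1 / 2 := by
  simp only [smoothStep]
  rw [halfPosSq_of_nonneg (by norm_num), halfPosSq_of_nonneg (by norm_num),
    halfPosSq_of_nonpos (by norm_num)]
  norm_num

theorem smoothStep_nonneg (a : ℝ) : 0 ≤ smoothStep a := by
  rcases le_total a 0 with h | h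
  · rw [smoothStep_of_nonpos h]
  · exact smoothStep_zero ▸ smoothStep_monotone h

theorem smoothStep_le_one (a : ℝ) : smoothStep a ≤ 1 := by
  rcases le_total 1 a with h | h
  · rw [smoothStep_of_one_le h]
  · exact (smoothStep_monotone h).trans (smoothStep_of_one_le le_rfl).le

/-! ### The link of the chain -/

/-- One link of the chain: large `a` creates an incentive to increase `b`. -/
noncomputable def link (a b : ℝ) : ℝ :=
  -(smoothStep a * (4 * smoothStep ((b + 2) / 4))) + halfPosSq (-b)

/-- The partial derivative of `link` in the first variable. -/
noncomputable def linkFst (a b : ℝ) : ℝ := -(hat a * (4 * smoothStep ((b + 2) / 4)))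

/-- The partial derivative of `link` in the second variable. -/
noncomputable def linkSnd (a b : ℝ) : ℝ := -(smoothStep a * hat ((b + 2) / 4)) - max (-b) 0

theorem hasDerivAt_link_comp {E : Type*} [NormedAddCommGroup E] [NormedSpace ℝ E]
    {a b : E → ℝ} {a' b' : E →L[ℝ] ℝ} {x : E} (ha : HasFDerivAt a a' x)
    (hb : HasFDerivAt b b' x) :
    HasFDerivAt (fun z => link (a z) (b z))
      (linkFst (a x) (b x) • a' + linkSnd (a x) (b x) • b') x := by
  have h1 : HasFDerivAt (fun z => smoothStep (a z)) (hat (a x) • a') x :=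
    (hasDerivAt_smoothStep (a x)).comp_hasFDerivAt x ha
  have h2 : HasDerivAt (fun b : ℝ => 4 * smoothStep ((b + 2) / 4)) (hat ((b x + 2) / 4)) (b x) := by
    have h3 : HasDerivAt (fun b : ℝ => (b + 2) / 4) (1 / 4) (b x) :=
      ((hasDerivAt_id (b x)).add_const 2).div_const 4
    have h4 := ((hasDerivAt_smoothStep ((b x + 2) / 4)).comp (b x) h3).const_mul 4
    exact h4.congr_deriv (by ring)
  have h5 : HasFDerivAt (fun z => 4 * smoothStep ((b z + 2) / 4))
      (hat ((b x + 2) / 4) • b') x := h2.comp_hasFDerivAt x hb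
  have h6 : HasFDerivAt (fun z => halfPosSq (-b z)) ((-max (-b x) 0) • b') x := by
    have h7 : HasDerivAt (fun b : ℝ => halfPosSq (-b)) (-max (-b x) 0) (b x) := by
      have := (hasDerivAt_halfPosSq (-b x)).comp (b x) (hasDerivAt_neg (b x))
      exact this.congr_deriv (by ring)
    exact h7.comp_hasFDerivAt x hb
  refine ((h1.mul h5).neg.add h6).congr_fderiv ?_
  ext z
  simp [linkFst, linkSnd]
  ring

theorem neg_four_le_link (a b : ℝ) : -4 ≤ link a b := by
  have h1 := smoothStep_nonneg a
  have h2 := smoothStep_le_one a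
  have h3 := smoothStep_nonneg ((b + 2) / 4)
  have h4 := smoothStep_le_one ((b + 2) / 4)
  have h5 := halfPosSq_nonneg (-b)
  unfold link
  nlinarith

/-- With `link_one_two`: all links reach their lower bound `-4` simultaneously when every coordinate
is `2`, so the infimum of a chain is known exactly. -/
theorem link_two_two : link 2 2 = -4 := by
  unfold link
  rw [smoothStep_of_one_le (by norm_num), smoothStep_of_one_le (by norm_num),
    halfPosSq_of_nonpos (by norm_num)]
  norm_num

theorem link_one_two : link 1 2 = -4 := by
  unfold link
  rw [smoothStep_of_one_le (by norm_num), smoothStep_of_one_le (by norm_num),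
    halfPosSq_of_nonpos (by norm_num)]
  norm_num

theorem link_one_zero : link 1 0 = -2 := by
  unfold link
  rw [smoothStep_of_one_le (by norm_num), show ((0 : ℝ) + 2) / 4 = 1 / 2 by norm_num,
    smoothStep_half, halfPosSq_of_nonpos (by norm_num)]
  norm_num

theorem link_zero_zero : link 0 0 = 0 := by
  unfold link
  rw [smoothStep_zero, halfPosSq_of_nonpos (by norm_num)]
  norm_num

/-- With `linkSnd_zero_zero` this is the zero-chain property: a vanishing coordinate feels no force
from the link leaving it, nor from the link entering it if its predecessor vanishes too. -/
theorem linkFst_zero (b : ℝ) : linkFst 0 b = 0 := by simp [linkFst, hat_zero]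

theorem linkSnd_zero_zero : linkSnd 0 0 = 0 := by simp [linkSnd, smoothStep_zero]

theorem abs_linkSnd_zero_le (a : ℝ) : |linkSnd a 0| ≤ 2 := by
  have h1 := smoothStep_nonneg a
  have h2 := smoothStep_le_one a
  have h3 := hat_nonneg ((0 + 2) / 4)
  have h4 := hat_le_two ((0 + 2) / 4)
  simp only [linkSnd, neg_zero, max_self, sub_zero, abs_neg]
  rw [abs_of_nonneg (by positivity)]
  nlinarith

/-- The sign guarantees that the following link cannot cancel the negative slope of
`linkSnd_le_neg_one`. -/
theorem linkFst_nonpos (a b : ℝ) : linkFst a b ≤ 0 := by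
  have h1 := hat_nonneg a
  have h3 := smoothStep_nonneg ((b + 2) / 4)
  unfold linkFst
  have : 0 ≤ hat a * (4 * smoothStep ((b + 2) / 4)) := by positivity
  linarith

/-- For `b ≤ -1` the quadratic penalty suffices; for `-1 ≤ b ≤ 1` the argument `(b + 2) / 4` lies in
`[1/4, 3/4]`, where `hat` is at least `1`. -/
theorem linkSnd_le_neg_one {a b : ℝ} (ha : 1 ≤ a) (hb : b ≤ 1) : linkSnd a b ≤ -1 := by
  unfold linkSnd
  rw [smoothStep_of_one_le ha, one_mul]
  rcases le_total b (-1) with h | h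
  · have h1 := hat_nonneg ((b + 2) / 4)
    have h2 := le_max_left (-b) 0
    linarith
  · have h1 : 1 ≤ hat ((b + 2) / 4) := one_le_hat (by linarith) (by linarith)
    have h2 := le_max_right (-b) 0
    linarith

theorem abs_mul_sub_mul_le {a b a' b' A B : ℝ} (ha : |a| ≤ A) (hb : |b'| ≤ B) :
    |a * b - a' * b'| ≤ A * |b - b'| + B * |a - a'| := by
  have : a * b - a' * b' = a * (b - b') + b' * (a - a') := by ring
  rw [this]
  refine (abs_add_le _ _).trans ?_
  rw [abs_mul, abs_mul]
  gcongr

theorem abs_linkFst_sub_le (a b a' b' : ℝ) :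
    |linkFst a b - linkFst a' b'| ≤ 16 * (|a - a'| + |b - b'|) := by
  have h := abs_mul_sub_mul_le (a := hat a) (b := 4 * smoothStep ((b + 2) / 4)) (a' := hat a')
    (b' := 4 * smoothStep ((b' + 2) / 4)) (A := 2) (B := 4)
    (by rw [abs_of_nonneg (hat_nonneg a)]; exact hat_le_two a)
    (by
      have h1 := smoothStep_nonneg ((b' + 2) / 4)
      have h2 := smoothStep_le_one ((b' + 2) / 4)
      rw [abs_of_nonneg (by positivity)]; linarith)
  have h1 := abs_hat_sub_le a a'
  have h2 := abs_smoothStep_sub_le ((b + 2) / 4) ((b' + 2) / 4)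
  have h3 : |(b + 2) / 4 - (b' + 2) / 4| = |b - b'| / 4 := by
    rw [show (b + 2) / 4 - (b' + 2) / 4 = (b - b') / 4 by ring, abs_div]; norm_num
  have h4 : |4 * smoothStep ((b + 2) / 4) - 4 * smoothStep ((b' + 2) / 4)|
      = 4 * |smoothStep ((b + 2) / 4) - smoothStep ((b' + 2) / 4)| := by
    rw [← mul_sub, abs_mul]; norm_num
  have h5 : linkFst a b - linkFst a' b' = -(hat a * (4 * smoothStep ((b + 2) / 4))
      - hat a' * (4 * smoothStep ((b' + 2) / 4))) := by unfold linkFst; ring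
  rw [h5, abs_neg]
  rw [h4] at h
  rw [h3] at h2
  have := abs_nonneg (b - b')
  linarith

theorem abs_linkSnd_sub_le (a b a' b' : ℝ) :
    |linkSnd a b - linkSnd a' b'| ≤ 16 * (|a - a'| + |b - b'|) := by
  have h := abs_mul_sub_mul_le (a := smoothStep a) (b := hat ((b + 2) / 4)) (a' := smoothStep a')
    (b' := hat ((b' + 2) / 4)) (A := 1) (B := 2)
    (by rw [abs_of_nonneg (smoothStep_nonneg a)]; exact smoothStep_le_one a)
    (by rw [abs_of_nonneg (hat_nonneg _)]; exact hat_le_two _)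
  have h1 := abs_smoothStep_sub_le a a'
  have h2 := abs_hat_sub_le ((b + 2) / 4) ((b' + 2) / 4)
  have h3 : |(b + 2) / 4 - (b' + 2) / 4| = |b - b'| / 4 := by
    rw [show (b + 2) / 4 - (b' + 2) / 4 = (b - b') / 4 by ring, abs_div]; norm_num
  have h4 : |max (-b) 0 - max (-b') 0| ≤ |b - b'| := by
    refine (abs_max_sub_max_le_abs _ _ _).trans (le_of_eq ?_)
    rw [← abs_neg]; congr 1; ring
  have h5 : linkSnd a b - linkSnd a' b' = -((smoothStep a * hat ((b + 2) / 4)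
      - smoothStep a' * hat ((b' + 2) / 4)) + (max (-b) 0 - max (-b') 0)) := by
    unfold linkSnd; ring
  rw [h5, abs_neg]
  refine (abs_add_le _ _).trans ?_
  rw [h3] at h2
  have := abs_nonneg (b - b')
  have := abs_nonneg (a - a')
  linarith

/-! ### Chain functions along an orthonormal sequence -/

section Chain

variable {E : Type*} [NormedAddCommGroup E] [InnerProductSpace ℝ E]

/-- `u 0, …, u T` are orthonormal. -/
def OrthonormalUpTo (u : ℕ → E) (T : ℕ) : Prop :=
  ∀ j ≤ T, ∀ k ≤ T, inner ℝ (u j) (u k) = if j = k then (1 : ℝ) else 0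

/-- The coordinates of `x / σ` along `u`, preceded by the constant `1`. -/
noncomputable def chainCoord (σ : ℝ) (u : ℕ → E) (x : E) : ℕ → ℝ
  | 0 => 1
  | k + 1 => inner ℝ (u k) x / σ

/-- The links selected by the weights `α`, together with a quadratic in the direction `u T`. -/
noncomputable def chainFun (T : ℕ) (σ l : ℝ) (u : ℕ → E) (α : ℕ → ℝ) (x : E) : ℝ :=
  l * σ ^ 2 / 64 * ∑ k ∈ Finset.range T,
    α k * link (chainCoord σ u x k) (chainCoord σ u x (k + 1)) + l / 2 * inner ℝ (u T) x ^ 2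

/-- The partial derivative of the sum of links in the coordinate `j + 1`. -/
noncomputable def chainPartial (σ : ℝ) (u : ℕ → E) (α : ℕ → ℝ) (x : E) (j : ℕ) : ℝ :=
  α j * linkSnd (chainCoord σ u x j) (chainCoord σ u x (j + 1))
    + α (j + 1) * linkFst (chainCoord σ u x (j + 1)) (chainCoord σ u x (j + 2))

/-- The coefficients of the gradient of `chainFun` along `u`. -/
noncomputable def chainGradCoeff (T : ℕ) (σ l : ℝ) (u : ℕ → E) (α : ℕ → ℝ) (x : E) (j : ℕ) : ℝ :=
  if j < T then l * σ / 64 * chainPartial σ u α x j else l * inner ℝ (u T) x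

/-- The gradient of `chainFun`. -/
noncomputable def chainGrad (T : ℕ) (σ l : ℝ) (u : ℕ → E) (α : ℕ → ℝ) (x : E) : E :=
  ∑ j ∈ Finset.range (T + 1), chainGradCoeff T σ l u α x j • u j

variable {T : ℕ} {σ l : ℝ} {u : ℕ → E} {α : ℕ → ℝ}

theorem hasFDerivAt_chainCoord_zero (x : E) :
    HasFDerivAt (fun z => chainCoord σ u z 0) (0 : E →L[ℝ] ℝ) x :=
  hasFDerivAt_const 1 x

theorem hasFDerivAt_chainCoord_succ (k : ℕ) (x : E) :
    HasFDerivAt (fun z => chainCoord σ u z (k + 1)) (σ⁻¹ • innerSL ℝ (u k)) x := by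
  have h := ((innerSL ℝ (u k)).hasFDerivAt (x := x)).const_mul σ⁻¹
  refine h.congr_of_eventuallyEq (Filter.Eventually.of_forall fun z => ?_)
  simp [chainCoord, div_eq_inv_mul]

/-- An index shift collects the two links that share a coordinate. Its boundary terms vanish because
coordinate `0` is constant and `α T = 0`. -/
theorem hasGradientAt_chainFun [CompleteSpace E] (hσ : σ ≠ 0) (hα : α T = 0) (x : E) :
    HasGradientAt (chainFun T σ l u α) (chainGrad T σ l u α x) x := by
  rw [hasGradientAt_iff_hasFDerivAt]
  set c := chainCoord σ u x with hc
  set e : ℕ → (E →L[ℝ] ℝ) := fun k => Nat.casesOn k 0 fun k => σ⁻¹ • innerSL ℝ (u k) with he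
  have h1 : ∀ k, HasFDerivAt (fun z => chainCoord σ u z k) (e k) x := by
    rintro (_ | k)
    · exact hasFDerivAt_chainCoord_zero x
    · exact hasFDerivAt_chainCoord_succ k x
  have h2 : ∀ k ∈ Finset.range T, HasFDerivAt
      (fun z => α k * link (chainCoord σ u z k) (chainCoord σ u z (k + 1)))
      (α k • (linkFst (c k) (c (k + 1)) • e k + linkSnd (c k) (c (k + 1)) • e (k + 1))) x :=
    fun k _ => (hasDerivAt_link_comp (h1 k) (h1 (k + 1))).const_mul (α k)
  have h3 := (HasFDerivAt.fun_sum h2).const_mul (l * σ ^ 2 / 64)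
  have h4 : HasFDerivAt (fun z => l / 2 * inner ℝ (u T) z ^ 2)
      ((l * inner ℝ (u T) x) • innerSL ℝ (u T)) x := by
    have h5 := (((innerSL ℝ (u T)).hasFDerivAt (x := x)).pow 2).const_mul (l / 2)
    refine (h5.congr_fderiv ?_)
    ext z
    simp
    ring
  refine (h3.add h4).congr_fderiv ?_
  have h6 : ∑ k ∈ Finset.range T, α k • (linkFst (c k) (c (k + 1)) • e k
      + linkSnd (c k) (c (k + 1)) • e (k + 1))
      = ∑ k ∈ Finset.range T, chainPartial σ u α x k • e (k + 1) := by
    have h7 : ∑ k ∈ Finset.range T, (α k * linkFst (c k) (c (k + 1))) • e k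
        = ∑ k ∈ Finset.range T, (α (k + 1) * linkFst (c (k + 1)) (c (k + 2))) • e (k + 1) := by
      have h8 := Finset.sum_range_succ (fun k => (α k * linkFst (c k) (c (k + 1))) • e k) T
      have h9 := Finset.sum_range_succ' (fun k => (α k * linkFst (c k) (c (k + 1))) • e k) T
      rw [h8] at h9
      simpa [hα, he] using h9
    simp only [smul_add, smul_smul, Finset.sum_add_distrib, chainPartial, add_smul]
    rw [h7, add_comm]
  rw [h6]
  ext z
  simp only [chainGrad, Finset.sum_range_succ, chainGradCoeff, lt_irrefl, if_false]
  have h10 : ∑ k ∈ Finset.range T, (if k < T then l * σ / 64 * chainPartial σ u α x k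
      else l * inner ℝ (u T) x) • u k
      = ∑ k ∈ Finset.range T, (l * σ / 64 * chainPartial σ u α x k) • u k :=
    Finset.sum_congr rfl fun k hk => by rw [if_pos (Finset.mem_range.mp hk)]
  rw [h10]
  simp only [he, _root_.add_apply, _root_.smul_apply,
    _root_.sum_apply, innerSL_apply_apply, InnerProductSpace.toDual_apply_apply,
    inner_add_left, sum_inner, inner_smul_left, smul_eq_mul, Finset.mul_sum]
  congr 1
  refine Finset.sum_congr rfl fun k _ => ?_
  simp
  field_simp

theorem inner_sum_smul_of_orthonormalUpTo (ho : OrthonormalUpTo u T) (c : ℕ → ℝ) {j : ℕ}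
    (hj : j ≤ T) : inner ℝ (u j) (∑ k ∈ Finset.range (T + 1), c k • u k) = c j := by
  rw [inner_sum, Finset.sum_eq_single j]
  · rw [inner_smul_right, ho j hj j hj]; simp
  · intro k hk hkj
    rw [inner_smul_right, ho j hj k (by simpa [Nat.lt_succ_iff] using hk), if_neg hkj.symm,
      mul_zero]
  · intro h
    exact absurd (Finset.mem_range.mpr (Nat.lt_succ_of_le hj)) h

theorem norm_sq_sum_smul_of_orthonormalUpTo (ho : OrthonormalUpTo u T) (c : ℕ → ℝ) :
    ‖∑ k ∈ Finset.range (T + 1), c k • u k‖ ^ 2 = ∑ k ∈ Finset.range (T + 1), c k ^ 2 := by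
  rw [← real_inner_self_eq_norm_sq, sum_inner]
  refine Finset.sum_congr rfl fun k hk => ?_
  rw [inner_smul_left, inner_sum_smul_of_orthonormalUpTo ho c
    (by simpa [Nat.lt_succ_iff] using hk)]
  simp [sq]

theorem sum_sq_inner_le_of_orthonormalUpTo (ho : OrthonormalUpTo u T) (x : E) :
    ∑ k ∈ Finset.range (T + 1), inner ℝ (u k) x ^ 2 ≤ ‖x‖ ^ 2 := by
  set y := ∑ k ∈ Finset.range (T + 1), inner ℝ (u k) x • u k with hy
  have h1 : inner ℝ x y = ∑ k ∈ Finset.range (T + 1), inner ℝ (u k) x ^ 2 := by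
    rw [hy, inner_sum]
    refine Finset.sum_congr rfl fun k _ => ?_
    rw [inner_smul_right, real_inner_comm, sq]
  have h2 : ‖y‖ ^ 2 = ∑ k ∈ Finset.range (T + 1), inner ℝ (u k) x ^ 2 :=
    norm_sq_sum_smul_of_orthonormalUpTo ho fun k => inner ℝ (u k) x
  have h3 := norm_sub_sq_real x y
  rw [h1, h2] at h3
  nlinarith [sq_nonneg ‖x - y‖]

theorem inner_chainGrad (ho : OrthonormalUpTo u T) (x : E) {j : ℕ} (hj : j ≤ T) :
    inner ℝ (u j) (chainGrad T σ l u α x) = chainGradCoeff T σ l u α x j :=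
  inner_sum_smul_of_orthonormalUpTo ho _ hj

theorem norm_eq_one_of_orthonormalUpTo (ho : OrthonormalUpTo u T) {j : ℕ} (hj : j ≤ T) :
    ‖u j‖ = 1 := by
  have := ho j hj j hj
  rw [real_inner_self_eq_norm_sq, if_pos rfl] at this
  nlinarith [norm_nonneg (u j)]

theorem abs_inner_le_norm_of_orthonormalUpTo (ho : OrthonormalUpTo u T) {j : ℕ} (hj : j ≤ T)
    (x : E) : |inner ℝ (u j) x| ≤ ‖x‖ := by
  have := abs_real_inner_le_norm (u j) x
  rwa [norm_eq_one_of_orthonormalUpTo ho hj, one_mul] at this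

theorem sq_chainPartial_sub_le (hα0 : ∀ k, 0 ≤ α k) (hα1 : ∀ k, α k ≤ 1) (x z : E) (j : ℕ) :
    (chainPartial σ u α x j - chainPartial σ u α z j) ^ 2
      ≤ 1024 * ((chainCoord σ u x j - chainCoord σ u z j) ^ 2
        + 2 * (chainCoord σ u x (j + 1) - chainCoord σ u z (j + 1)) ^ 2
        + α (j + 1) * (chainCoord σ u x (j + 2) - chainCoord σ u z (j + 2)) ^ 2) := by
  set c := chainCoord σ u x
  set d := chainCoord σ u z
  have h1 := abs_linkSnd_sub_le (c j) (c (j + 1)) (d j) (d (j + 1))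
  have h2 := abs_linkFst_sub_le (c (j + 1)) (c (j + 2)) (d (j + 1)) (d (j + 2))
  have h3 : |chainPartial σ u α x j - chainPartial σ u α z j|
      ≤ 16 * (|c j - d j| + 2 * |c (j + 1) - d (j + 1)| + α (j + 1) * |c (j + 2) - d (j + 2)|) := by
    have h4 : chainPartial σ u α x j - chainPartial σ u α z j
        = α j * (linkSnd (c j) (c (j + 1)) - linkSnd (d j) (d (j + 1)))
        + α (j + 1) * (linkFst (c (j + 1)) (c (j + 2)) - linkFst (d (j + 1)) (d (j + 2))) := by
      simp only [chainPartial]; ring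
    rw [h4]
    refine (abs_add_le _ _).trans ?_
    rw [abs_mul, abs_mul, abs_of_nonneg (hα0 _), abs_of_nonneg (hα0 _)]
    have h5 := mul_le_mul_of_nonneg_left h2 (hα0 (j + 1))
    have h6 := mul_le_of_le_one_left (abs_nonneg (linkSnd (c j) (c (j + 1))
      - linkSnd (d j) (d (j + 1)))) (hα1 j)
    have h7 := mul_le_of_le_one_left (abs_nonneg (c (j + 1) - d (j + 1))) (hα1 (j + 1))
    linarith
  rw [← sq_abs (chainPartial σ u α x j - chainPartial σ u α z j), ← sq_abs (c j - d j),
    ← sq_abs (c (j + 1) - d (j + 1)), ← sq_abs (c (j + 2) - d (j + 2))]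
  have h5 := pow_le_pow_left₀ (abs_nonneg _) h3 2
  have hp := abs_nonneg (c j - d j)
  have hq := abs_nonneg (c (j + 1) - d (j + 1))
  have hr := abs_nonneg (c (j + 2) - d (j + 2))
  generalize |c j - d j| = p at *
  generalize |c (j + 1) - d (j + 1)| = q at *
  generalize |c (j + 2) - d (j + 2)| = r at *
  have ha0 := hα0 (j + 1)
  have ha1 := hα1 (j + 1)
  generalize α (j + 1) = a at *
  have h6 : (a * r) ^ 2 ≤ a * r ^ 2 := by
    have : 0 ≤ a * (1 - a) * r ^ 2 := by
      have := sub_nonneg.mpr ha1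
      positivity
    nlinarith
  -- Cauchy–Schwarz with weights `1, 2, 1`, of total `4`, and `16 ^ 2 * 4 = 1024`.
  nlinarith [sq_nonneg (p - q), sq_nonneg (p - a * r), sq_nonneg (q - a * r)]

/-- After summation each coordinate increment is counted at most `1 + 2 + 1` times, and `1024 * 4 =
64 ^ 2`; hence the normalization by `64` in `chainFun`. The factor `α (j + 1)` removes the term in
the direction `u T`, which is reserved for the quadratic. -/
theorem sum_sq_chainPartial_sub_le (hσ : 0 < σ) (hα : α T = 0) (hα0 : ∀ k, 0 ≤ α k)
    (hα1 : ∀ k, α k ≤ 1) (x z : E) :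
    ∑ j ∈ Finset.range T, (chainPartial σ u α x j - chainPartial σ u α z j) ^ 2
      ≤ (64 / σ) ^ 2 * ∑ j ∈ Finset.range T, inner ℝ (u j) (x - z) ^ 2 := by
  set δ : ℕ → ℝ := fun j => (chainCoord σ u x j - chainCoord σ u z j) ^ 2 with hδ
  have hδ0 : δ 0 = 0 := by simp [hδ, chainCoord]
  have hδn : ∀ j, 0 ≤ δ j := fun j => sq_nonneg _
  have hδs : ∀ j, δ (j + 1) = (1 / σ) ^ 2 * inner ℝ (u j) (x - z) ^ 2 := by
    intro j
    simp only [hδ, chainCoord, inner_sub_right]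
    field_simp
  have h1 : ∑ j ∈ Finset.range T, δ j ≤ ∑ j ∈ Finset.range T, δ (j + 1) := by
    have h8 := Finset.sum_range_succ δ T
    have h9 := Finset.sum_range_succ' δ T
    have := hδn T
    linarith
  have h2 : ∑ j ∈ Finset.range T, α (j + 1) * δ (j + 2) ≤ ∑ j ∈ Finset.range T, δ (j + 1) := by
    cases T with
    | zero => simp
    | succ n =>
      rw [Finset.sum_range_succ, hα, zero_mul, add_zero, Finset.sum_range_succ']
      have h3 : ∑ j ∈ Finset.range n, α (j + 1) * δ (j + 2)
          ≤ ∑ j ∈ Finset.range n, δ (j + 1 + 1) :=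
        Finset.sum_le_sum fun j _ => mul_le_of_le_one_left (hδn _) (hα1 _)
      have := hδn (0 + 1)
      linarith
  calc ∑ j ∈ Finset.range T, (chainPartial σ u α x j - chainPartial σ u α z j) ^ 2
      ≤ ∑ j ∈ Finset.range T, 1024 * (δ j + 2 * δ (j + 1) + α (j + 1) * δ (j + 2)) :=
        Finset.sum_le_sum fun j _ => sq_chainPartial_sub_le hα0 hα1 x z j
    _ = 1024 * (∑ j ∈ Finset.range T, δ j + 2 * ∑ j ∈ Finset.range T, δ (j + 1)
          + ∑ j ∈ Finset.range T, α (j + 1) * δ (j + 2)) := by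
        rw [← Finset.mul_sum, Finset.sum_add_distrib, Finset.sum_add_distrib, ← Finset.mul_sum]
    _ ≤ 4096 * ∑ j ∈ Finset.range T, δ (j + 1) := by linarith
    _ = (64 / σ) ^ 2 * ∑ j ∈ Finset.range T, inner ℝ (u j) (x - z) ^ 2 := by
        simp only [hδs]
        rw [← Finset.mul_sum]
        ring

theorem norm_chainGrad_sub_le (hσ : 0 < σ) (hl : 0 ≤ l) (ho : OrthonormalUpTo u T)
    (hα : α T = 0) (hα0 : ∀ k, 0 ≤ α k) (hα1 : ∀ k, α k ≤ 1) (x z : E) :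
    ‖chainGrad T σ l u α x - chainGrad T σ l u α z‖ ≤ l * ‖x - z‖ := by
  refine le_of_sq_le_sq ?_ (by positivity)
  have h1 : chainGrad T σ l u α x - chainGrad T σ l u α z = ∑ j ∈ Finset.range (T + 1),
      (chainGradCoeff T σ l u α x j - chainGradCoeff T σ l u α z j) • u j := by
    simp only [chainGrad, sub_smul, Finset.sum_sub_distrib]
  rw [h1, norm_sq_sum_smul_of_orthonormalUpTo ho, Finset.sum_range_succ]
  have h2 : ∑ j ∈ Finset.range T, (chainGradCoeff T σ l u α x j
      - chainGradCoeff T σ l u α z j) ^ 2 = (l * σ / 64) ^ 2 * ∑ j ∈ Finset.range T,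
        (chainPartial σ u α x j - chainPartial σ u α z j) ^ 2 := by
    rw [Finset.mul_sum]
    refine Finset.sum_congr rfl fun j hj => ?_
    simp only [chainGradCoeff, if_pos (Finset.mem_range.mp hj)]
    ring
  have h3 : (chainGradCoeff T σ l u α x T - chainGradCoeff T σ l u α z T) ^ 2
      = l ^ 2 * inner ℝ (u T) (x - z) ^ 2 := by
    simp only [chainGradCoeff, lt_irrefl, if_false, inner_sub_right]
    ring
  have h4 := sum_sq_chainPartial_sub_le (u := u) hσ hα hα0 hα1 x z
  have h5 := sum_sq_inner_le_of_orthonormalUpTo ho (x - z)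
  rw [Finset.sum_range_succ] at h5
  rw [h2, h3]
  have h6 := mul_le_mul_of_nonneg_left h4 (sq_nonneg (l * σ / 64))
  have h7 := mul_le_mul_of_nonneg_left h5 (sq_nonneg l)
  have h8 : (l * σ / 64) ^ 2 * ((64 / σ) ^ 2 * ∑ j ∈ Finset.range T, inner ℝ (u j) (x - z) ^ 2)
      = l ^ 2 * ∑ j ∈ Finset.range T, inner ℝ (u j) (x - z) ^ 2 := by
    field_simp
  rw [h8] at h6
  rw [mul_pow]
  linarith

/-- Minimality is the purpose of the quadratic term: in the direction `u T` the gradient has slope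
exactly `l`. -/
theorem isLeast_lipschitz_chainGrad (hσ : 0 < σ) (hl : 0 ≤ l) (ho : OrthonormalUpTo u T)
    (hα : α T = 0) (hα0 : ∀ k, 0 ≤ α k) (hα1 : ∀ k, α k ≤ 1) :
    IsLeast {K : ℝ | 0 ≤ K ∧ ∀ x z, ‖chainGrad T σ l u α x - chainGrad T σ l u α z‖
      ≤ K * ‖x - z‖} l := by
  refine ⟨⟨hl, norm_chainGrad_sub_le hσ hl ho hα hα0 hα1⟩, fun K hK => ?_⟩
  have h1 := hK.2 (u T) 0
  rw [sub_zero, norm_eq_one_of_orthonormalUpTo ho le_rfl, mul_one] at h1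
  refine le_trans ?_ h1
  refine le_trans ?_ (abs_inner_le_norm_of_orthonormalUpTo ho (le_refl T) _)
  rw [inner_sub_right, inner_chainGrad ho _ le_rfl, inner_chainGrad ho _ le_rfl]
  simp only [chainGradCoeff, lt_irrefl, if_false, ho T le_rfl T le_rfl, inner_zero_right]
  simpa using le_abs_self l

theorem neg_le_chainFun (hl : 0 ≤ l) (hα0 : ∀ k, 0 ≤ α k) (x : E) :
    -(4 * (l * σ ^ 2 / 64) * ∑ k ∈ Finset.range T, α k) ≤ chainFun T σ l u α x := by
  have h1 : ∑ k ∈ Finset.range T, α k * (-4) ≤ ∑ k ∈ Finset.range T,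
      α k * link (chainCoord σ u x k) (chainCoord σ u x (k + 1)) :=
    Finset.sum_le_sum fun k _ => mul_le_mul_of_nonneg_left (neg_four_le_link _ _) (hα0 k)
  have h2 := mul_le_mul_of_nonneg_left h1 (show 0 ≤ l * σ ^ 2 / 64 by positivity)
  rw [← Finset.sum_mul] at h2
  have h3 : 0 ≤ l / 2 * inner ℝ (u T) x ^ 2 := by positivity
  unfold chainFun
  linarith

theorem chainFun_zero (hT : 0 < T) : chainFun T σ l u α 0 = -(2 * (l * σ ^ 2 / 64) * α 0) := by
  obtain ⟨n, rfl⟩ := Nat.exists_eq_succ_of_ne_zero hT.ne'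
  have h1 : ∀ k, chainCoord σ u (0 : E) (k + 1) = 0 := fun k => by simp [chainCoord]
  unfold chainFun
  rw [Finset.sum_range_succ', Finset.sum_eq_zero]
  · rw [h1, show chainCoord σ u (0 : E) 0 = 1 from rfl, link_one_zero]
    simp
    ring
  · intro k _
    rw [h1, h1, link_zero_zero, mul_zero]

theorem chainFun_sum (hσ : σ ≠ 0) (ho : OrthonormalUpTo u T) :
    chainFun T σ l u α (∑ k ∈ Finset.range (T + 1), (if k < T then 2 * σ else 0) • u k)
      = -(4 * (l * σ ^ 2 / 64) * ∑ k ∈ Finset.range T, α k) := by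
  set x := ∑ k ∈ Finset.range (T + 1), (if k < T then 2 * σ else 0) • u k with hx
  have h1 : ∀ j ≤ T, inner ℝ (u j) x = if j < T then 2 * σ else 0 := fun j hj =>
    inner_sum_smul_of_orthonormalUpTo ho (fun k => if k < T then 2 * σ else 0) hj
  have h2 : ∀ j < T, chainCoord σ u x (j + 1) = 2 := fun j hj => by
    simp only [chainCoord, h1 j hj.le, if_pos hj]
    field_simp
  have h3 : ∀ k ∈ Finset.range T,
      α k * link (chainCoord σ u x k) (chainCoord σ u x (k + 1)) = α k * (-4) := by
    intro k hk
    rw [Finset.mem_range] at hk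
    rw [h2 k hk]
    cases k with
    | zero => rw [show chainCoord σ u x 0 = 1 from rfl, link_one_two]
    | succ k => rw [h2 k (by omega), link_two_two]
  unfold chainFun
  rw [Finset.sum_congr rfl h3, ← Finset.sum_mul, h1 T le_rfl]
  simp
  ring

theorem norm_sq_chainGrad_zero_le (hT : 0 < T) (ho : OrthonormalUpTo u T) (hα1 : α 0 ^ 2 = α 0) :
    ‖chainGrad T σ l u α 0‖ ^ 2 ≤ (l * σ / 64) ^ 2 * (4 * α 0) := by
  obtain ⟨n, rfl⟩ := Nat.exists_eq_succ_of_ne_zero hT.ne'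
  have h1 : ∀ k, chainCoord σ u (0 : E) (k + 1) = 0 := fun k => by simp [chainCoord]
  unfold chainGrad
  rw [norm_sq_sum_smul_of_orthonormalUpTo ho, Finset.sum_range_succ, Finset.sum_range_succ',
    Finset.sum_eq_zero]
  · simp only [chainGradCoeff, lt_irrefl, if_false, inner_zero_right, Nat.succ_pos, if_true,
      chainPartial, h1, linkFst_zero]
    have h2 := abs_linkSnd_zero_le (chainCoord σ u (0 : E) 0)
    have h3 : linkSnd (chainCoord σ u (0 : E) 0) 0 ^ 2 ≤ 4 := by
      have := sq_le_sq' (neg_le_of_abs_le h2) (le_of_abs_le h2)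
      linarith
    have h5 : 0 ≤ α 0 := hα1 ▸ sq_nonneg _
    have h4 := mul_le_mul_of_nonneg_left h3 (show 0 ≤ (l * σ / 64) ^ 2 * α 0 by positivity)
    rw [mul_zero, add_zero, zero_add, mul_zero, zero_pow two_ne_zero, add_zero, mul_pow, mul_pow,
      hα1]
    linarith
  · intro k hk
    rw [Finset.mem_range] at hk
    simp only [chainGradCoeff, if_pos (show k + 1 < n.succ by omega), chainPartial, h1,
      linkFst_zero, linkSnd_zero_zero]
    simp

/-- If the coordinates of `x` vanish from `u n` on, then the gradient lies in the span of
`u 0, …, u (n - 1)`, provided that the link `n` is inactive at `x`. -/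
theorem chainGrad_mem_span {n : ℕ} {x : E} (hn : n ≤ T)
    (hx : ∀ j, n ≤ j → j ≤ T → inner ℝ (u j) x = 0)
    (hlink : α n = 0 ∨ 0 < n ∧ inner ℝ (u (n - 1)) x = 0) :
    chainGrad T σ l u α x ∈ Submodule.span ℝ (u '' Set.Iio n) := by
  refine Submodule.sum_mem _ fun j hj => ?_
  rw [Finset.mem_range, Nat.lt_succ_iff] at hj
  rcases lt_or_ge j n with h | h
  · exact Submodule.smul_mem _ _ (Submodule.subset_span ⟨j, h, rfl⟩)
  · have h0 : chainGradCoeff T σ l u α x j = 0 := by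
      unfold chainGradCoeff
      split_ifs with hjT
      · have h1 : chainCoord σ u x (j + 1) = 0 := by simp [chainCoord, hx j h hj]
        have h2 : α j * linkSnd (chainCoord σ u x j) (chainCoord σ u x (j + 1)) = 0 := by
          -- Only `j = n` needs `hlink`; for `j > n` the preceding coordinate vanishes by `hx`.
          rcases h.eq_or_lt with h | h
          · rcases hlink with h3 | ⟨h3, h4⟩
            · rw [← h, h3, zero_mul]
            · obtain ⟨k, rfl⟩ := Nat.exists_eq_succ_of_ne_zero h3.ne'
              have h5 : chainCoord σ u x j = 0 := by
                rw [← h]; simpa [chainCoord] using Or.inl h4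
              rw [h1, h5, linkSnd_zero_zero, mul_zero]
          · obtain ⟨k, rfl⟩ := Nat.exists_eq_succ_of_ne_zero (Nat.ne_zero_of_lt h)
            have h5 : chainCoord σ u x (k + 1) = 0 := by
              simp [chainCoord, hx k (by omega) (by omega)]
            rw [h1, h5, linkSnd_zero_zero, mul_zero]
        rw [chainPartial, h2, h1, linkFst_zero]
        simp
      · rw [hx T (by omega) le_rfl, mul_zero]
    rw [h0, zero_smul]
    exact Submodule.zero_mem _

theorem exists_one_le_and_lt_one {c : ℕ → ℝ} (h0 : 1 ≤ c 0) {T : ℕ} (hT : c T < 1) :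
    ∃ j < T, 1 ≤ c j ∧ c (j + 1) < 1 := by
  induction T with
  | zero => linarith
  | succ n ih =>
    rcases lt_or_ge (c n) 1 with h | h
    · obtain ⟨j, hj, h1⟩ := ih h
      exact ⟨j, by omega, h1⟩
    · exact ⟨n, by omega, h, hT⟩

end Chain

/-! ### Vectors that are out of reach of finitely many linear operators -/

section Reach

variable {E ι : Type*} [NormedAddCommGroup E] [InnerProductSpace ℝ E]

/-- What can be produced from `X` in `t` rounds of applying the operators and taking linear
combinations. -/
def reach (ops : ι → E →ₗ[ℝ] E) (X : Submodule ℝ E) : ℕ → Submodule ℝ E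
  | 0 => X
  | t + 1 => reach ops X t ⊔ ⨆ i, (reach ops X t).map (ops i)

variable {ops : ι → E →ₗ[ℝ] E}

theorem reach_le_succ (X : Submodule ℝ E) (t : ℕ) : reach ops X t ≤ reach ops X (t + 1) :=
  le_sup_left

theorem reach_mono_right (X : Submodule ℝ E) : Monotone (reach ops X) :=
  monotone_nat_of_le_succ (reach_le_succ X)

theorem reach_mono_left {X Y : Submodule ℝ E} (h : X ≤ Y) (t : ℕ) :
    reach ops X t ≤ reach ops Y t := by
  induction t with
  | zero => exact h
  | succ t ih => exact sup_le_sup ih (iSup_mono fun i => Submodule.map_mono ih)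

theorem apply_mem_reach_succ {X : Submodule ℝ E} {t : ℕ} {x : E} (hx : x ∈ reach ops X t)
    (i : ι) : ops i x ∈ reach ops X (t + 1) :=
  (le_sup_right : _ ≤ reach ops X (t + 1))
    (Submodule.mem_iSup_of_mem i (Submodule.mem_map_of_mem hx))

open Classical in
-- The bound depends on the number of operators and rounds but not on the operators, so the
-- dimension can be fixed before the algorithm's operators are known.
theorem exists_finset_span_eq_reach [Fintype ι] (s : Finset E) (t : ℕ) :
    ∃ s' : Finset E, reach ops (Submodule.span ℝ (s : Set E)) t = Submodule.span ℝ (s' : Set E) ∧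
      s'.card ≤ (1 + Fintype.card ι) ^ t * s.card := by
  induction t with
  | zero => exact ⟨s, rfl, by simp⟩
  | succ t ih =>
    obtain ⟨s', h1, h2⟩ := ih
    refine ⟨s' ∪ Finset.univ.biUnion fun i => s'.image (ops i), ?_, ?_⟩
    · simp only [reach, h1, Submodule.map_span, Finset.coe_union, Finset.coe_biUnion,
        Finset.coe_image, Submodule.span_union, Finset.coe_univ, Set.mem_univ, Set.iUnion_true,
        Submodule.span_iUnion]
    · have h3 : (Finset.univ.biUnion fun i => s'.image (ops i)).card
          ≤ Fintype.card ι * s'.card := by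
        refine Finset.card_biUnion_le.trans ?_
        refine (Finset.sum_le_sum fun i _ => Finset.card_image_le).trans ?_
        simp
      calc _ ≤ s'.card + Fintype.card ι * s'.card := (Finset.card_union_le _ _).trans (by omega)
        _ = (1 + Fintype.card ι) * s'.card := by ring
        _ ≤ (1 + Fintype.card ι) * ((1 + Fintype.card ι) ^ t * s.card) :=
          Nat.mul_le_mul_left _ h2
        _ = _ := by ring

theorem exists_unit_orthogonal [FiniteDimensional ℝ E] {W : Submodule ℝ E}
    (hW : Module.finrank ℝ W < Module.finrank ℝ E) :
    ∃ v : E, ‖v‖ = 1 ∧ ∀ x ∈ W, inner ℝ v x = 0 := by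
  have h1 : Wᗮ ≠ ⊥ := by
    intro h
    have h2 := Submodule.finrank_add_finrank_orthogonal W
    rw [h, finrank_bot] at h2
    omega
  obtain ⟨v, hv, hv0⟩ := Submodule.exists_mem_ne_zero_of_ne_bot h1
  refine ⟨(‖v‖⁻¹ : ℝ) • v, ?_, fun x hx => ?_⟩
  · rw [norm_smul, norm_inv, norm_norm, inv_mul_cancel₀ (norm_ne_zero_iff.mpr hv0)]
  · rw [inner_smul_left, Submodule.inner_left_of_mem_orthogonal hx hv, mul_zero]

/-- In large dimension there are orthonormal vectors each of which is orthogonal to everything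
that the given operators make out of its predecessors within `τ` rounds. -/
theorem exists_orthonormal_out_of_reach [Fintype ι] [FiniteDimensional ℝ E] (T τ : ℕ)
    (hdim : (1 + Fintype.card ι) ^ τ * (T + 1) < Module.finrank ℝ E) (ops : ι → E →ₗ[ℝ] E) :
    ∃ u : ℕ → E, OrthonormalUpTo u T ∧ ∀ k ≤ T, ∀ t ≤ τ,
      ∀ x ∈ reach ops (Submodule.span ℝ (u '' Set.Iio k)) t, inner ℝ (u k) x = 0 := by
  classical
  have key : ∀ n ≤ T + 1, ∃ u : ℕ → E, ∀ k < n, ‖u k‖ = 1 ∧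
      ∀ x ∈ reach ops (Submodule.span ℝ (u '' Set.Iio k)) τ, inner ℝ (u k) x = 0 := by
    intro n hn
    induction n with
    | zero => exact ⟨0, fun k hk => absurd hk (Nat.not_lt_zero k)⟩
    | succ n ih =>
      obtain ⟨u, hu⟩ := ih (by omega)
      obtain ⟨s', h1, h2⟩ := exists_finset_span_eq_reach (ops := ops)
        ((Finset.range n).image u) τ
      have h3 : (((Finset.range n).image u : Finset E) : Set E) = u '' Set.Iio n := by simp
      rw [h3] at h1
      obtain ⟨v, hv1, hv2⟩ := exists_unit_orthogonal
        (W := reach ops (Submodule.span ℝ (u '' Set.Iio n)) τ) (by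
          rw [h1]
          refine (finrank_span_finset_le_card s').trans_lt (h2.trans_lt (lt_of_le_of_lt ?_ hdim))
          refine Nat.mul_le_mul_left _ (Finset.card_image_le.trans ?_)
          simp only [Finset.card_range]
          omega)
      have himg : ∀ k ≤ n, Function.update u n v '' Set.Iio k = u '' Set.Iio k := by
        intro k hk
        refine Set.image_congr fun j hj => ?_
        exact Function.update_of_ne (by have : j < k := hj; omega) _ _
      refine ⟨Function.update u n v, fun k hk => ?_⟩
      rw [himg k (by omega)]
      rcases (Nat.lt_succ_iff.mp hk).eq_or_lt with rfl | h
      · rw [Function.update_self]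
        exact ⟨hv1, hv2⟩
      · rw [Function.update_of_ne h.ne]
        exact hu k h
  obtain ⟨u, hu⟩ := key (T + 1) le_rfl
  -- Round `0` of `reach` is the span itself, so being out of reach includes orthogonality to the
  -- predecessors.
  have hlt : ∀ j k, j < k → k ≤ T → inner ℝ (u k) (u j) = 0 := fun j k hjk hk =>
    (hu k (by omega)).2 _ (reach_mono_right _ (Nat.zero_le τ) (Submodule.subset_span ⟨j, hjk, rfl⟩))
  refine ⟨u, fun j hj k hk => ?_, fun k hk t ht x hx =>
    (hu k (by omega)).2 x (reach_mono_right _ ht hx)⟩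
  rcases lt_trichotomy j k with h | h | h
  · rw [if_neg h.ne, real_inner_comm, hlt j k h hk]
  · subst h
    rw [if_pos rfl, real_inner_self_eq_norm_sq, (hu j (by omega)).1, one_pow]
  · rw [if_neg h.ne', hlt k j h hj]

end Reach

/-! ### Shortest paths -/

/-- `v 0, …, v D` is a shortest path in `G`. -/
structure IsGeodesic {V : Type*} (G : SimpleGraph V) (v : ℕ → V) (D : ℕ) : Prop where
  adj : ∀ j < D, G.Adj (v j) (v (j + 1))
  dist : ∀ j ≤ D, G.dist (v 0) (v j) = j

section Geodesic

variable {V : Type*} {G : SimpleGraph V} {v : ℕ → V} {D : ℕ}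

/-- If an initial piece of a shortest walk were not shortest, the triangle inequality would shorten
the whole walk. -/
theorem isGeodesic_getVert (hG : G.Connected) {a b : V} (w : G.Walk a b)
    (hw : w.length = G.dist a b) : IsGeodesic G w.getVert w.length := by
  refine ⟨fun j hj => w.adj_getVert_succ hj, fun j hj => ?_⟩
  rw [SimpleGraph.Walk.getVert_zero]
  have h1 := SimpleGraph.dist_le (w.take j)
  have h2 := SimpleGraph.dist_le (w.drop j)
  rw [SimpleGraph.Walk.take_length, min_eq_left hj] at h1
  rw [SimpleGraph.Walk.drop_length] at h2
  have h3 := hG.dist_triangle (u := a) (v := w.getVert j) (w := b)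
  omega

theorem IsGeodesic.injOn (hv : IsGeodesic G v D) {i j : ℕ} (hi : i ≤ D) (hj : j ≤ D)
    (h : v i = v j) : i = j := by
  rw [← hv.dist i hi, ← hv.dist j hj, h]

theorem SimpleGraph.Connected.dist_le_dist_add_one (hG : G.Connected) (a : V) {i j : V}
    (h : G.Adj i j) : G.dist a j ≤ G.dist a i + 1 := by
  have h1 := hG.dist_triangle (u := a) (v := i) (w := j)
  rwa [SimpleGraph.dist_eq_one_iff_adj.mpr h] at h1

/-- Distances from `v 0` differ by at most one across an edge, so a shortest path has no chords. -/
theorem IsGeodesic.eq_succ_or_of_adj (hv : IsGeodesic G v D) (hG : G.Connected) {i j : ℕ}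
    (hi : i ≤ D) (hj : j ≤ D) (h : G.Adj (v i) (v j)) : j = i + 1 ∨ i = j + 1 := by
  have h1 := hG.dist_le_dist_add_one (v 0) h
  have h2 := hG.dist_le_dist_add_one (v 0) h.symm
  rw [hv.dist i hi, hv.dist j hj] at h1 h2
  have h3 : i ≠ j := fun e => h.ne (by rw [e])
  omega

/-- A sum over all nodes that is supported on the path. -/
theorem IsGeodesic.sum_eq [Fintype V] (hv : IsGeodesic G v D) {F : V → ℝ}
    (hF : ∀ i, (¬ ∃ j ≤ D, v j = i) → F i = 0) :
    ∑ i, F i = ∑ j ∈ Finset.range (D + 1), F (v j) := by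
  symm
  refine Finset.sum_of_injOn v ?_ (fun _ _ => Finset.mem_coe.mpr (Finset.mem_univ _)) ?_
    fun _ _ => rfl
  · intro i hi j hj h
    simp only [Finset.coe_range, Set.mem_Iio, Nat.lt_succ_iff] at hi hj
    exact hv.injOn hi hj h
  · intro i _ hi
    refine hF i fun ⟨j, hj, h⟩ => hi ⟨j, ?_, h⟩
    simpa [Nat.lt_succ_iff] using hj

/-- A sum over all edges that is supported on the edges between nodes of the path. -/
theorem IsGeodesic.sum_edge_eq {M : ℕ} {G : SimpleGraph (Fin M)} {v : ℕ → Fin M}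
    (hv : IsGeodesic G v D) (hG : G.Connected) {h : Fin M → Fin M → ℝ}
    (hsymm : ∀ a b, h a b = h b a) (hzero : ∀ a b, (¬ ∃ j ≤ D, v j = a) → h a b = 0) :
    ∑ e : GraphEdge G, h e.1.1 e.1.2 = ∑ j ∈ Finset.range D, h (v j) (v (j + 1)) := by
  classical
  symm
  rw [Finset.sum_range]
  have hex : ∀ j : Fin D, ∃ e : GraphEdge G,
      (e.1.1 = v j ∧ e.1.2 = v (j + 1)) ∨ (e.1.1 = v (j + 1) ∧ e.1.2 = v j) := by
    intro j
    have hadj := hv.adj j j.2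
    rcases lt_or_gt_of_ne hadj.ne with hlt | hlt
    · exact ⟨⟨(v (j + 1), v j), hlt, hadj.symm⟩, Or.inr ⟨rfl, rfl⟩⟩
    · exact ⟨⟨(v j, v (j + 1)), hlt, hadj⟩, Or.inl ⟨rfl, rfl⟩⟩
  choose e he using hex
  refine Finset.sum_of_injOn e ?_ (fun _ _ => Finset.mem_coe.mpr (Finset.mem_univ _)) ?_ ?_
  · intro i _ j _ hij
    have hi := i.2
    have hj := j.2
    have h1 := he i
    have h2 := he j
    rw [hij] at h1
    ext
    rcases h1 with ⟨h3, h4⟩ | ⟨h3, h4⟩ <;> rcases h2 with ⟨h5, h6⟩ | ⟨h5, h6⟩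
    · exact hv.injOn hi.le hj.le (h3.symm.trans h5)
    · have h7 := hv.injOn hi.le hj (h3.symm.trans h5)
      have h8 := hv.injOn hi hj.le (h4.symm.trans h6)
      omega
    · have h7 := hv.injOn hi hj.le (h3.symm.trans h5)
      have h8 := hv.injOn hi.le hj (h4.symm.trans h6)
      omega
    · exact hv.injOn hi.le hj.le (h4.symm.trans h6)
  · intro f _ hf
    by_contra hne
    have h1 : ∃ j ≤ D, v j = f.1.1 := by
      by_contra hc
      exact hne (hzero _ _ hc)
    have h2 : ∃ j ≤ D, v j = f.1.2 := by
      by_contra hc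
      exact hne ((hsymm _ _).trans (hzero _ _ hc))
    obtain ⟨a, ha, hav⟩ := h1
    obtain ⟨b, hb, hbv⟩ := h2
    have hadj : G.Adj (v a) (v b) := by rw [hav, hbv]; exact f.2.2
    have hlt : f.1.2 < f.1.1 := f.2.1
    apply hf
    rcases hv.eq_succ_or_of_adj hG ha hb hadj with rfl | rfl
    · refine ⟨⟨a, by omega⟩, Finset.mem_coe.mpr (Finset.mem_univ _), ?_⟩
      rcases he ⟨a, by omega⟩ with ⟨h3, h4⟩ | ⟨h3, h4⟩
      · exact Subtype.ext (Prod.ext (h3.trans hav) (h4.trans hbv))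
      · have h5 := (e ⟨a, by omega⟩).2.1
        rw [h3, h4] at h5
        simp only [hav, hbv] at h5
        exact absurd hlt h5.asymm
    · refine ⟨⟨b, by omega⟩, Finset.mem_coe.mpr (Finset.mem_univ _), ?_⟩
      rcases he ⟨b, by omega⟩ with ⟨h3, h4⟩ | ⟨h3, h4⟩
      · have h5 := (e ⟨b, by omega⟩).2.1
        rw [h3, h4] at h5
        simp only [hav, hbv] at h5
        exact absurd hlt h5.asymm
      · exact Subtype.ext (Prod.ext (h3.trans hav) (h4.trans hbv))
  · intro j _
    rcases he j with ⟨h3, h4⟩ | ⟨h3, h4⟩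
    · rw [h3, h4]
    · rw [h3, h4, hsymm]

/-- The Lipschitz constants `l` on the nodes of the path and `0` elsewhere. -/
noncomputable def pathLipschitz (v : ℕ → V) (D : ℕ) (l : ℝ) (i : V) : ℝ :=
  open Classical in if ∃ j ≤ D, v j = i then l else 0

theorem pathLipschitz_of_mem {l : ℝ} {i : V} (h : ∃ j ≤ D, v j = i) :
    pathLipschitz v D l i = l := if_pos h

theorem pathLipschitz_of_notMem {l : ℝ} {i : V} (h : ¬ ∃ j ≤ D, v j = i) :
    pathLipschitz v D l i = 0 := if_neg h

theorem pathLipschitz_apply {l : ℝ} {j : ℕ} (hj : j ≤ D) : pathLipschitz v D l (v j) = l :=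
  pathLipschitz_of_mem ⟨j, hj, rfl⟩

/-- The distance from the first third of a shortest path of length `D` that starts at `a`,
truncated at the gap between its first and its last third. -/
noncomputable def thirdDist (G : SimpleGraph V) (a : V) (D : ℕ) (i : V) : ℕ :=
  min (G.dist a i - D / 3) (D - 2 * (D / 3))

/-- For even `k` the distance from the first third of a path, for odd `k` that from the last. -/
noncomputable def sideDist (G : SimpleGraph V) (a : V) (D : ℕ) (k : ℕ) (i : V) : ℕ :=
  if Even k then thirdDist G a D i else D - 2 * (D / 3) - thirdDist G a D i

theorem thirdDist_le (a : V) (i : V) : thirdDist G a D i ≤ D - 2 * (D / 3) := min_le_right _ _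

/-- Truncation and reflection keep the distance from `a` 1-Lipschitz: one communication round gains
at most one unit. -/
theorem sideDist_le_add_one (hG : G.Connected) (a : V) {i j : V} (h : G.Adj i j) (k : ℕ) :
    sideDist G a D k i ≤ sideDist G a D k j + 1 := by
  have h1 := hG.dist_le_dist_add_one a h
  have h2 := hG.dist_le_dist_add_one a h.symm
  unfold sideDist thirdDist
  split_ifs <;> omega

/-- A node owning one link is thus at the full gap from the owners of the next; this is the delay
per link. -/
theorem sideDist_add_sideDist_succ (a : V) (i : V) (k : ℕ) :
    sideDist G a D k i + sideDist G a D (k + 1) i = D - 2 * (D / 3) := by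
  have := thirdDist_le (G := G) (D := D) a i
  simp only [sideDist, Nat.even_add_one]
  by_cases h : Even k
  · rw [if_pos h, if_neg (not_not.mpr h)]; omega
  · rw [if_neg h, if_pos h]; omega

open Classical in
theorem IsGeodesic.card_sideDist_eq_zero (hv : IsGeodesic G v D) (k : ℕ) :
    ((Finset.range (D + 1)).filter fun j => sideDist G (v 0) D k (v j) = 0).card = D / 3 + 1 := by
  by_cases hk : Even k
  · rw [← Finset.card_range (D / 3 + 1)]
    congr 1
    ext j
    simp only [Finset.mem_filter, Finset.mem_range, sideDist, if_pos hk, thirdDist]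
    constructor
    · rintro ⟨h1, h2⟩
      rw [hv.dist j (by omega)] at h2
      omega
    · intro h
      refine ⟨by omega, ?_⟩
      rw [hv.dist j (by omega)]
      omega
  · rw [show D / 3 + 1 = (Finset.Ico (D - D / 3) (D + 1)).card by rw [Nat.card_Ico]; omega]
    congr 1
    ext j
    simp only [Finset.mem_filter, Finset.mem_range, Finset.mem_Ico, sideDist, if_neg hk, thirdDist]
    constructor
    · rintro ⟨h1, h2⟩
      rw [hv.dist j (by omega)] at h2
      omega
    · intro h
      refine ⟨by omega, ?_⟩
      rw [hv.dist j (by omega)]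
      omega

theorem IsGeodesic.sum_pathLipschitz [Fintype V] (hv : IsGeodesic G v D) (l : ℝ) :
    ∑ i, pathLipschitz v D l i = (D + 1) * l := by
  rw [hv.sum_eq fun i hi => pathLipschitz_of_notMem hi,
    Finset.sum_congr rfl fun j hj => pathLipschitz_apply (by simpa [Nat.lt_succ_iff] using hj)]
  simp

theorem IsGeodesic.sum_pathLipschitz_mul [Fintype V] (hv : IsGeodesic G v D) (l : ℝ) (k : ℕ) :
    ∑ i, pathLipschitz v D l i * (if sideDist G (v 0) D k i = 0 then (1 : ℝ) else 0)
      = (D / 3 + 1 : ℕ) * l := by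
  classical
  rw [hv.sum_eq fun i hi => by rw [pathLipschitz_of_notMem hi, zero_mul],
    Finset.sum_congr rfl fun j hj => by
      rw [pathLipschitz_apply (by simpa [Nat.lt_succ_iff] using hj)],
    ← Finset.mul_sum, Finset.sum_boole, hv.card_sideDist_eq_zero, mul_comm]

end Geodesic

/-! ### Spectral estimates -/

section Spectral

open Matrix

variable {M : ℕ} {G : SimpleGraph (Fin M)}

theorem exists_mulVec_eq_smul_of_mem_spectrum {B : Matrix (Fin M) (Fin M) ℝ} {μ : ℝ}
    (h : μ ∈ spectrum ℝ B) : ∃ x : Fin M → ℝ, x ≠ 0 ∧ B *ᵥ x = μ • x := by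
  rw [← Matrix.spectrum_toLin', ← Module.End.hasEigenvalue_iff_mem_spectrum] at h
  obtain ⟨x, hx⟩ := h.exists_hasEigenvector
  exact ⟨x, hx.2, by simpa using hx.apply_eq_smul⟩

/-- The spectrum is finite and `B ≠ 0` has a nonzero eigenvalue, so the infimum is attained. -/
theorem lambdaMinPos_pos {B : Matrix (Fin M) (Fin M) ℝ} (hB : B.PosSemidef) (h0 : B ≠ 0) :
    0 < lambdaMinPos B := by
  have hsp := hB.isHermitian.spectrum_real_eq_range_eigenvalues
  set S := {μ | μ ∈ spectrum ℝ B ∧ μ ≠ 0} with hS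
  have hfin : S.Finite := Matrix.finite_real_spectrum.subset fun μ hμ => hμ.1
  have hne : S.Nonempty := by
    by_contra hc
    apply h0
    rw [← hB.isHermitian.eigenvalues_eq_zero_iff]
    ext i
    by_contra hi
    exact hc ⟨_, by rw [hsp]; exact ⟨i, rfl⟩, hi⟩
  have hmem : lambdaMinPos B ∈ S := hne.csInf_mem hfin
  have h1 := hmem.1
  rw [hsp] at h1
  obtain ⟨i, hi⟩ := h1
  exact lt_of_le_of_ne (hi ▸ hB.eigenvalues_nonneg i) hmem.2.symm

theorem graphDeg_pos {v w : Fin M} (h : G.Adj v w) : 0 < graphDeg G v := by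
  classical
  unfold graphDeg
  rw [Nat.cast_pos, SimpleGraph.degree_pos_iff_exists_adj]
  exact ⟨w, h⟩

theorem incidenceF_apply (e : GraphEdge G) (v : Fin M) :
    incidenceF G e v = if v = e.1.1 then 1 else if v = e.1.2 then -1 else 0 := by
  have h1 : 0 < graphDeg G e.1.1 := graphDeg_pos e.2.2
  have h2 : 0 < graphDeg G e.1.2 := graphDeg_pos e.2.2.symm
  simp only [incidenceF, sqrtDegMatrix, Matrix.mul_diagonal, incidenceA, Matrix.of_apply]
  split_ifs with h3 h4
  · rw [h3, one_div_mul_cancel (Real.sqrt_pos.mpr h1).ne']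
  · rw [h4, neg_mul, one_div_mul_cancel (Real.sqrt_pos.mpr h2).ne']
  · rw [zero_mul]

theorem incidenceF_mulVec (x : Fin M → ℝ) (e : GraphEdge G) :
    (incidenceF G *ᵥ x) e = x e.1.1 - x e.1.2 := by
  have hne : e.1.1 ≠ e.1.2 := e.2.2.ne
  simp only [Matrix.mulVec, dotProduct, incidenceF_apply]
  have h : ∀ v, (if v = e.1.1 then (1 : ℝ) else if v = e.1.2 then -1 else 0) * x v
      = (if v = e.1.1 then x v else 0) - (if v = e.1.2 then x v else 0) := by
    intro v
    split_ifs with h1 h2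
    · exact absurd (h1.symm.trans h2) hne
    all_goals simp
  simp only [h, Finset.sum_sub_distrib, Finset.sum_ite_eq', Finset.mem_univ, if_true]

theorem lambdaMinPos_laplacian_pos {v w : Fin M} (h : G.Adj v w) :
    0 < lambdaMinPos (sqrtDegMatrix G * graphLaplacian G * sqrtDegMatrix G) := by
  have h1 : sqrtDegMatrix G * graphLaplacian G * sqrtDegMatrix G
      = (incidenceF G)ᴴ * incidenceF G := by
    rw [Matrix.conjTranspose_eq_transpose_of_trivial, incidenceF, Matrix.transpose_mul,
      graphLaplacian, sqrtDegMatrix, Matrix.diagonal_transpose]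
    simp only [Matrix.mul_assoc]
  rw [h1]
  refine lambdaMinPos_pos (Matrix.posSemidef_conjTranspose_mul_self _) ?_
  rw [Ne, Matrix.conjTranspose_mul_self_eq_zero]
  intro h0
  obtain ⟨e⟩ : Nonempty (GraphEdge G) := by
    rcases lt_or_gt_of_ne h.ne with hlt | hlt
    · exact ⟨⟨(w, v), hlt, h.symm⟩⟩
    · exact ⟨⟨(v, w), hlt, h⟩⟩
  have h2 := incidenceF_apply e e.1.1
  rw [h0] at h2
  simp at h2

/-- The bilinear form of `hatLaplacian`. -/
theorem dotProduct_hatLaplacian_mulVec (L x z : Fin M → ℝ) :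
    z ⬝ᵥ hatLaplacian G L *ᵥ x = ∑ e : GraphEdge G, Real.sqrt (L e.1.1 * L e.1.2)
      * (((Real.sqrt (L e.1.1))⁻¹ * z e.1.1 - (Real.sqrt (L e.1.2))⁻¹ * z e.1.2)
        * ((Real.sqrt (L e.1.1))⁻¹ * x e.1.1 - (Real.sqrt (L e.1.2))⁻¹ * x e.1.2)) := by
  have hs : ∀ y : Fin M → ℝ, invSqrtL L *ᵥ y = fun i => (Real.sqrt (L i))⁻¹ * y i := by
    intro y
    ext i
    rw [invSqrtL, Matrix.mulVec_diagonal]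
  have hsT : (invSqrtL L)ᵀ = invSqrtL L := Matrix.diagonal_transpose _
  have h1 : z ⬝ᵥ hatLaplacian G L *ᵥ x = (incidenceF G *ᵥ (invSqrtL L *ᵥ z)) ⬝ᵥ
      (edgeK G L *ᵥ (incidenceF G *ᵥ (invSqrtL L *ᵥ x))) := by
    have h2 : hatLaplacian G L *ᵥ x = (invSqrtL L)ᵀ *ᵥ ((incidenceF G)ᵀ *ᵥ
        (edgeK G L *ᵥ (incidenceF G *ᵥ (invSqrtL L *ᵥ x)))) := by
      rw [hsT]
      simp only [hatLaplacian, Matrix.mulVec_mulVec, Matrix.mul_assoc]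
    rw [h2, Matrix.dotProduct_mulVec, Matrix.vecMul_transpose, Matrix.dotProduct_mulVec,
      Matrix.vecMul_transpose]
  rw [h1]
  simp only [dotProduct, edgeK, Matrix.mulVec_diagonal, incidenceF_mulVec, hs]
  refine Finset.sum_congr rfl fun e _ => ?_
  ring

theorem hatLaplacian_mulVec_eq_zero {L : Fin M → ℝ} (x : Fin M → ℝ) {i : Fin M} (hi : L i = 0) :
    (hatLaplacian G L *ᵥ x) i = 0 := by
  simp only [hatLaplacian, Matrix.mul_assoc]
  rw [← Matrix.mulVec_mulVec, invSqrtL, Matrix.mulVec_diagonal, hi]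
  simp

theorem sum_sq_sub_le (y : ℕ → ℝ) (D : ℕ) :
    ∑ j ∈ Finset.range D, (y j - y (j + 1)) ^ 2 ≤ 4 * ∑ j ∈ Finset.range (D + 1), y j ^ 2 := by
  have h1 : ∑ j ∈ Finset.range D, (y j - y (j + 1)) ^ 2
      ≤ ∑ j ∈ Finset.range D, (2 * y j ^ 2 + 2 * y (j + 1) ^ 2) :=
    Finset.sum_le_sum fun j _ => by nlinarith [sq_nonneg (y j + y (j + 1))]
  rw [Finset.sum_add_distrib, ← Finset.mul_sum, ← Finset.mul_sum] at h1
  have h2 := Finset.sum_range_succ (fun j => y j ^ 2) D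
  have h3 := Finset.sum_range_succ' (fun j => y j ^ 2) D
  have h4 := sq_nonneg (y D)
  have h5 := sq_nonneg (y 0)
  linarith

/-- Telescoping and Cauchy–Schwarz. -/
theorem sq_sub_le_mul_sum (y : ℕ → ℝ) {D a b : ℕ} (ha : a ≤ D) (hb : b ≤ D) :
    (y a - y b) ^ 2 ≤ D * ∑ j ∈ Finset.range D, (y j - y (j + 1)) ^ 2 := by
  wlog hab : a ≤ b generalizing a b
  · rw [← neg_sub, neg_sq]
    exact this hb ha (le_of_not_ge hab)
  have h1 : |y a - y b| ≤ ∑ j ∈ Finset.range D, |y j - y (j + 1)| := by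
    have h2 := dist_le_Ico_sum_dist y hab
    simp only [Real.dist_eq] at h2
    refine h2.trans (Finset.sum_le_sum_of_subset_of_nonneg ?_ fun _ _ _ => abs_nonneg _)
    intro j hj
    simp only [Finset.mem_Ico, Finset.mem_range] at hj ⊢
    omega
  have h3 := sq_sum_le_card_mul_sum_sq (s := Finset.range D) (f := fun j => |y j - y (j + 1)|)
  simp only [sq_abs, Finset.card_range] at h3
  rw [← sq_abs]
  exact (pow_le_pow_left₀ (abs_nonneg _) h1 2).trans h3

/-- A discrete Poincaré inequality on a path. -/
theorem sum_sq_le_of_sum_eq_zero {y : ℕ → ℝ} {D : ℕ} (h : ∑ j ∈ Finset.range (D + 1), y j = 0) :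
    ∑ j ∈ Finset.range (D + 1), y j ^ 2
      ≤ (D + 1) ^ 2 * ∑ j ∈ Finset.range D, (y j - y (j + 1)) ^ 2 := by
  set E := ∑ j ∈ Finset.range D, (y j - y (j + 1)) ^ 2 with hE
  have hE0 : 0 ≤ E := Finset.sum_nonneg fun j _ => sq_nonneg _
  have h1 : ∀ a ∈ Finset.range (D + 1), y a ^ 2 ≤ (D + 1) * E := by
    intro a ha
    -- Since `y` sums to zero, some `y b` does not have the strict sign of `y a`, whence `y a ^ 2 ≤
    -- (y a - y b) ^ 2`.
    obtain ⟨b, hb, hab⟩ : ∃ b ∈ Finset.range (D + 1), y a * y b ≤ 0 := by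
      refine Finset.exists_le_of_sum_le (g := fun _ => (0 : ℝ)) ⟨a, ha⟩ ?_
      rw [← Finset.mul_sum, h]
      simp
    rw [Finset.mem_range, Nat.lt_succ_iff] at ha hb
    have h2 := sq_sub_le_mul_sum y ha hb
    nlinarith [sq_nonneg (y b)]
  refine (Finset.sum_le_sum h1).trans (le_of_eq ?_)
  simp
  ring

variable {v : ℕ → Fin M} {D : ℕ} {l : ℝ}

/-- On the path, `√(l * l)` cancels the two factors `l^{-1/2}`; every edge with an end off the path
has weight `0`. -/
theorem IsGeodesic.hatLaplacian_quadratic (hv : IsGeodesic G v D) (hG : G.Connected) (hl : 0 < l)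
    (x : Fin M → ℝ) :
    x ⬝ᵥ hatLaplacian G (pathLipschitz v D l) *ᵥ x
      = ∑ j ∈ Finset.range D, (x (v j) - x (v (j + 1))) ^ 2 := by
  set L := pathLipschitz v D l with hL
  rw [dotProduct_hatLaplacian_mulVec, hv.sum_edge_eq hG (h := fun a b => Real.sqrt (L a * L b)
      * (((Real.sqrt (L a))⁻¹ * x a - (Real.sqrt (L b))⁻¹ * x b)
        * ((Real.sqrt (L a))⁻¹ * x a - (Real.sqrt (L b))⁻¹ * x b)))]
  · refine Finset.sum_congr rfl fun j hj => ?_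
    rw [Finset.mem_range] at hj
    rw [hL, pathLipschitz_apply hj.le, pathLipschitz_apply (Nat.succ_le_of_lt hj),
      Real.sqrt_mul_self hl.le]
    have h1 : (Real.sqrt l)⁻¹ * (Real.sqrt l)⁻¹ = l⁻¹ := by
      rw [← mul_inv, Real.mul_self_sqrt hl.le]
    calc _ = l * ((Real.sqrt l)⁻¹ * (Real.sqrt l)⁻¹) * (x (v j) - x (v (j + 1))) ^ 2 := by ring
      _ = _ := by rw [h1, mul_inv_cancel₀ hl.ne', one_mul]
  · intro a b
    rw [mul_comm (L a)]
    ring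
  · intro a b ha
    rw [hL, pathLipschitz_of_notMem ha]
    simp

/-- `L^{-1/2}` maps `√L` to the indicator of the path, which is constant along every edge of nonzero
weight. -/
theorem dotProduct_sqrt_pathLipschitz_hatLaplacian (x : Fin M → ℝ) :
    (fun i => Real.sqrt (pathLipschitz v D l i)) ⬝ᵥ
      hatLaplacian G (pathLipschitz v D l) *ᵥ x = 0 := by
  rw [dotProduct_hatLaplacian_mulVec]
  refine Finset.sum_eq_zero fun e _ => ?_
  by_cases h1 : ∃ j ≤ D, v j = e.1.1
  · by_cases h2 : ∃ j ≤ D, v j = e.1.2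
    · rw [pathLipschitz_of_mem h1, pathLipschitz_of_mem h2]
      simp
    · rw [pathLipschitz_of_notMem h2]
      simp
  · rw [pathLipschitz_of_notMem h1]
    simp

/-- An eigenvector for `μ ≠ 0` vanishes off the path and is orthogonal to `√L`, so it has mean zero
on the path. Its Rayleigh quotient is bounded below by the Poincaré inequality and above by
`sum_sq_sub_le`. -/
theorem IsGeodesic.eigenvalue_bounds (hv : IsGeodesic G v D) (hG : G.Connected) (hl : 0 < l)
    {μ : ℝ} (hμ : μ ∈ spectrum ℝ (hatLaplacian G (pathLipschitz v D l))) (h0 : μ ≠ 0) :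
    1 / ((D : ℝ) + 1) ^ 2 ≤ μ ∧ μ ≤ 4 := by
  obtain ⟨x, hx0, hx⟩ := exists_mulVec_eq_smul_of_mem_spectrum hμ
  have hoff : ∀ i, (¬ ∃ j ≤ D, v j = i) → x i = 0 := by
    intro i hi
    have h1 := hatLaplacian_mulVec_eq_zero (G := G) x (pathLipschitz_of_notMem (l := l) hi)
    rw [hx, Pi.smul_apply, smul_eq_mul] at h1
    exact (mul_eq_zero.mp h1).resolve_left h0
  have hsum : ∑ j ∈ Finset.range (D + 1), x (v j) = 0 := by
    have h1 := dotProduct_sqrt_pathLipschitz_hatLaplacian (G := G) (v := v) (D := D) (l := l) x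
    rw [hx, dotProduct_smul, smul_eq_mul] at h1
    have h2 := (mul_eq_zero.mp h1).resolve_left h0
    rw [dotProduct, hv.sum_eq fun i hi => by rw [hoff i hi, mul_zero],
      Finset.sum_congr rfl fun j hj => by
        rw [pathLipschitz_apply (by simpa [Nat.lt_succ_iff] using hj)], ← Finset.mul_sum] at h2
    exact (mul_eq_zero.mp h2).resolve_left (Real.sqrt_pos.mpr hl).ne'
  have hq := hv.hatLaplacian_quadratic hG hl x
  have hxx : x ⬝ᵥ x = ∑ j ∈ Finset.range (D + 1), x (v j) ^ 2 := by
    rw [dotProduct, hv.sum_eq fun i hi => by rw [hoff i hi, mul_zero]]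
    exact Finset.sum_congr rfl fun j _ => (sq _).symm
  have hpos : 0 < x ⬝ᵥ x :=
    lt_of_le_of_ne (Finset.sum_nonneg fun i _ => mul_self_nonneg _)
      (fun h => hx0 (dotProduct_self_eq_zero.mp h.symm))
  rw [hx, dotProduct_smul, smul_eq_mul] at hq
  have h1 := sum_sq_sub_le (fun j => x (v j)) D
  have h2 := sum_sq_le_of_sum_eq_zero hsum
  rw [← hxx, ← hq] at h1 h2
  constructor
  · rw [div_le_iff₀ (by positivity)]
    by_contra hc
    push Not at hc
    nlinarith
  · by_contra hc
    push Not at hc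
    nlinarith

theorem IsGeodesic.one_div_sqrt_spectralGap_le (hv : IsGeodesic G v D) (hG : G.Connected)
    (hl : 0 < l) :
    1 / Real.sqrt (spectralGap (hatLaplacian G (pathLipschitz v D l))) ≤ 2 * (D + 1) := by
  set B := hatLaplacian G (pathLipschitz v D l) with hB
  -- A nonpositive gap would make the left side `1 / 0 = 0`; a positive one provides a nonzero
  -- eigenvalue, as `sInf ∅ = 0`.
  rcases le_or_gt (spectralGap B) 0 with h | h
  · rw [Real.sqrt_eq_zero_of_nonpos h, div_zero]
    positivity
  have hmax : lambdaMax B ≤ 4 := by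
    refine Real.sSup_le (fun μ hμ => ?_) (by norm_num)
    rcases eq_or_ne μ 0 with rfl | h0
    · norm_num
    · exact (hv.eigenvalue_bounds hG hl hμ h0).2
  have hne : {μ | μ ∈ spectrum ℝ B ∧ μ ≠ 0}.Nonempty := by
    by_contra hc
    rw [Set.not_nonempty_iff_eq_empty] at hc
    rw [spectralGap, lambdaMinPos, hc, Real.sInf_empty, zero_div] at h
    exact lt_irrefl _ h
  have hmin : 1 / ((D : ℝ) + 1) ^ 2 ≤ lambdaMinPos B :=
    le_csInf hne fun μ hμ => (hv.eigenvalue_bounds hG hl hμ.1 hμ.2).1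
  have hminpos : 0 < lambdaMinPos B := lt_of_lt_of_le (by positivity) hmin
  have hmaxpos : 0 < lambdaMax B := by
    by_contra hc
    exact absurd h (not_lt.mpr (div_nonpos_of_nonneg_of_nonpos hminpos.le (not_lt.mp hc)))
  have h1 : (1 / (2 * ((D : ℝ) + 1))) ^ 2 ≤ spectralGap B := by
    rw [spectralGap, le_div_iff₀ hmaxpos]
    calc (1 / (2 * ((D : ℝ) + 1))) ^ 2 * lambdaMax B ≤ (1 / (2 * ((D : ℝ) + 1))) ^ 2 * 4 := by
          gcongr
      _ = 1 / ((D : ℝ) + 1) ^ 2 := by field_simp; norm_num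
      _ ≤ _ := hmin
  have h2 : 1 / (2 * ((D : ℝ) + 1)) ≤ Real.sqrt (spectralGap B) := Real.le_sqrt_of_sq_le h1
  rw [div_le_iff₀ (Real.sqrt_pos.mpr h)]
  rw [div_le_iff₀ (by positivity)] at h2
  linarith

end Spectral

/-! ### The hard instance -/

section ChainProblem

variable {M S T : ℕ} {σ : ℝ} {L : Fin M → ℝ} {u : ℕ → EuclideanSpace ℝ (Fin S)}
  {α : Fin M → ℕ → ℝ}

/-- The problem whose local functions are chain functions. -/
noncomputable def chainProblem (T : ℕ) (σ : ℝ) (L : Fin M → ℝ)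
    (u : ℕ → EuclideanSpace ℝ (Fin S)) (α : Fin M → ℕ → ℝ) (hσ : 0 < σ) (hL : ∀ i, 0 ≤ L i)
    (ho : OrthonormalUpTo u T) (hα : ∀ i, α i T = 0) (hα0 : ∀ i k, 0 ≤ α i k)
    (hα1 : ∀ i k, α i k ≤ 1) : DistProblem M where
  S := S
  f i := chainFun T σ (L i) u (α i)
  L := L
  differentiable i x := (hasGradientAt_chainFun hσ.ne' (hα i) x).hasFDerivAt.differentiableAt
  lipschitz i := by
    have h : gradient (chainFun T σ (L i) u (α i)) = chainGrad T σ (L i) u (α i) :=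
      funext fun x => (hasGradientAt_chainFun hσ.ne' (hα i) x).gradient
    rw [h]
    exact isLeast_lipschitz_chainGrad hσ (hL i) ho (hα i) (hα0 i) (hα1 i)
  bddBelow := by
    refine ⟨(1 / (M : ℝ)) * ∑ i, -(4 * (L i * σ ^ 2 / 64) * ∑ k ∈ Finset.range T, α i k), ?_⟩
    rintro _ ⟨x, rfl⟩
    refine mul_le_mul_of_nonneg_left (Finset.sum_le_sum fun i _ => ?_) (by positivity)
    exact neg_le_chainFun (hL i) (hα0 i) (x i)

variable {hσ : 0 < σ} {hL : ∀ i, 0 ≤ L i} {ho : OrthonormalUpTo u T} {hα : ∀ i, α i T = 0}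
  {hα0 : ∀ i k, 0 ≤ α i k} {hα1 : ∀ i k, α i k ≤ 1}

theorem gradient_chainProblem (i : Fin M) (x : EuclideanSpace ℝ (Fin S)) :
    gradient ((chainProblem T σ L u α hσ hL ho hα hα0 hα1).f i) x
      = chainGrad T σ (L i) u (α i) x :=
  (hasGradientAt_chainFun hσ.ne' (hα i) x).gradient

/-- Attained with every agent at the point whose chain coordinates are all `2`. -/
theorem iInf_obj_chainProblem :
    ⨅ x, (chainProblem T σ L u α hσ hL ho hα hα0 hα1).obj x
      = (1 / (M : ℝ)) * ∑ i, -(4 * (L i * σ ^ 2 / 64) * ∑ k ∈ Finset.range T, α i k) := by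
  refine le_antisymm ?_ ?_
  · refine (ciInf_le (chainProblem T σ L u α hσ hL ho hα hα0 hα1).bddBelow
      (fun _ => ∑ k ∈ Finset.range (T + 1), (if k < T then 2 * σ else 0) • u k)).trans ?_
    refine mul_le_mul_of_nonneg_left (Finset.sum_le_sum fun i _ => ?_) (by positivity)
    exact (chainFun_sum hσ.ne' ho).le
  · refine le_ciInf fun x => ?_
    refine mul_le_mul_of_nonneg_left (Finset.sum_le_sum fun i _ => ?_) (by positivity)
    exact neg_le_chainFun (hL i) (hα0 i) (x i)

theorem obj_chainProblem_zero (hT : 0 < T) :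
    (chainProblem T σ L u α hσ hL ho hα hα0 hα1).obj 0
      = (1 / (M : ℝ)) * ∑ i, -(2 * (L i * σ ^ 2 / 64) * α i 0) := by
  refine congrArg ((1 / (M : ℝ)) * ·) (Finset.sum_congr rfl fun i _ => ?_)
  exact chainFun_zero hT

theorem d0NormSq_chainProblem_nonneg :
    0 ≤ (chainProblem T σ L u α hσ hL ho hα hα0 hα1).d0NormSq :=
  Finset.sum_nonneg fun i _ => mul_nonneg (inv_nonneg.mpr (hL i)) (sq_nonneg _)

theorem d0NormSq_chainProblem_le (hT : 0 < T) (hsq : ∀ i, α i 0 ^ 2 = α i 0) :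
    (chainProblem T σ L u α hσ hL ho hα hα0 hα1).d0NormSq
      ≤ σ ^ 2 / 1024 * ∑ i, L i * α i 0 := by
  rw [Finset.mul_sum]
  refine Finset.sum_le_sum fun i _ => ?_
  change (L i)⁻¹ * ‖gradient (chainFun T σ (L i) u (α i)) 0‖ ^ 2 ≤ _
  rw [(hasGradientAt_chainFun hσ.ne' (hα i) 0).gradient]
  have h1 := norm_sq_chainGrad_zero_le (σ := σ) (l := L i) hT ho (hsq i)
  refine (mul_le_mul_of_nonneg_left h1 (inv_nonneg.mpr (hL i))).trans (le_of_eq ?_)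
  rcases eq_or_ne (L i) 0 with h | h
  · rw [h]; simp
  · field_simp
    ring

theorem isRun_chainProblem {a : DistAlgorithm M} {G : SimpleGraph (Fin M)}
    {x : ℕ → Fin M → EuclideanSpace ℝ (Fin S)}
    (hx : a.IsRun G (chainProblem T σ L u α hσ hL ho hα hα0 hα1) x) (t : ℕ) (i : Fin M) :
    x (t + 1) i ∈ Submodule.span ℝ
      ({z | ∃ k ≤ t, ∃ j, G.Adj i j ∧ z = a.Wv S L t i k j (a.Q S L k j (x k j))} ∪
       {z | ∃ k ≤ t, z = a.Wg S L t i k (chainGrad T σ (L i) u (α i) (x k i))} ∪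
       {z | ∃ k ≤ t, z = a.Wx S L t i k (x k i)}) := by
  have hg : ∀ k, chainGrad T σ (L i) u (α i) (x k i)
      = gradient (chainFun T σ (L i) u (α i)) (x k i) :=
    fun k => (gradient_chainProblem (hσ := hσ) (hL := hL) (ho := ho) (hα := hα) (hα0 := hα0)
      (hα1 := hα1) i (x k i)).symm
  simp only [hg]
  exact hx.2 t i

theorem localGap_chainProblem (G : SimpleGraph (Fin M)) (x : Fin M → EuclideanSpace ℝ (Fin S)) :
    (chainProblem T σ L u α hσ hL ho hα hα0 hα1).localGap G x
      = (‖∑ i, chainGrad T σ (L i) u (α i) (x i)‖ / M) ^ 2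
        + 1 / (M * lambdaMinPos (sqrtDegMatrix G * graphLaplacian G * sqrtDegMatrix G))
          * ∑ e : GraphEdge G, Real.sqrt (L e.1.1 * L e.1.2) * ‖x e.1.1 - x e.1.2‖ ^ 2 := by
  have h1 : ∑ i, chainGrad T σ (L i) u (α i) (x i)
      = ∑ i, gradient (chainFun T σ (L i) u (α i)) (x i) :=
    Finset.sum_congr rfl fun i _ => (gradient_chainProblem (hσ := hσ) (hL := hL) (ho := ho)
      (hα := hα) (hα0 := hα0) (hα1 := hα1) i (x i)).symm
  have h2 : ‖(1 / (M : ℝ)) • ∑ i, gradient (chainFun T σ (L i) u (α i)) (x i)‖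
      = ‖∑ i, chainGrad T σ (L i) u (α i) (x i)‖ / M := by
    rw [h1, norm_smul, Real.norm_of_nonneg (by positivity), one_div_mul_eq_div]
  rw [← h2]
  rfl

end ChainProblem

/-! ### Distribution of the links over the two ends of the path -/

section Weights

variable {M : ℕ} {G : SimpleGraph (Fin M)} {v : ℕ → Fin M} {D T : ℕ}

/-- The links `k < T` are assigned in turn to the two outer thirds of the path. -/
noncomputable def sideWeight (G : SimpleGraph (Fin M)) (a : Fin M) (D T : ℕ) (i : Fin M) (k : ℕ) :
    ℝ :=
  if k < T then (if sideDist G a D k i = 0 then 1 else 0) else 0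

theorem sideWeight_nonneg (a : Fin M) (i : Fin M) (k : ℕ) : 0 ≤ sideWeight G a D T i k := by
  unfold sideWeight; split_ifs <;> norm_num

theorem sideWeight_le_one (a : Fin M) (i : Fin M) (k : ℕ) : sideWeight G a D T i k ≤ 1 := by
  unfold sideWeight; split_ifs <;> norm_num

theorem sideWeight_sq (a : Fin M) (i : Fin M) (k : ℕ) :
    sideWeight G a D T i k ^ 2 = sideWeight G a D T i k := by
  unfold sideWeight; split_ifs <;> norm_num

theorem sideWeight_self (a : Fin M) (i : Fin M) : sideWeight G a D T i T = 0 :=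
  if_neg (lt_irrefl T)

theorem sideWeight_of_ne_zero {a : Fin M} {i : Fin M} {k : ℕ} (h : sideDist G a D k i ≠ 0) :
    sideWeight G a D T i k = 0 := by
  unfold sideWeight; rw [if_neg h, ite_self]

theorem IsGeodesic.sum_pathLipschitz_mul_sideWeight (hv : IsGeodesic G v D) (l : ℝ) {k : ℕ}
    (hk : k < T) : ∑ i, pathLipschitz v D l i * sideWeight G (v 0) D T i k
      = (D / 3 + 1 : ℕ) * l := by
  rw [← hv.sum_pathLipschitz_mul l k]
  simp only [sideWeight, if_pos hk]

theorem pathLipschitz_nonneg {l : ℝ} (hl : 0 ≤ l) (i : Fin M) : 0 ≤ pathLipschitz v D l i := by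
  unfold pathLipschitz; split_ifs <;> simp [hl]

end Weights

/-! ### Speed of information along the chain -/

section Progress

variable {M S : ℕ} {G : SimpleGraph (Fin M)} {D T : ℕ}

/-- All linear operators that the algorithm uses before time `τ`. -/
def DistAlgorithm.ops (a : DistAlgorithm M) (S : ℕ) (L : Fin M → ℝ) (τ : ℕ) :
    Fin τ × Fin M × Fin τ × (Fin M ⊕ Bool) →
      (EuclideanSpace ℝ (Fin S) →ₗ[ℝ] EuclideanSpace ℝ (Fin S))
  | (t, i, k, Sum.inl j) => a.Wv S L t i k j ∘ₗ a.Q S L k j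
  | (t, i, k, Sum.inr true) => a.Wg S L t i k
  | (t, i, k, Sum.inr false) => a.Wx S L t i k

/-- Progress along the chain is slow: before time `1 + k (d + 1) + sideDist k i`, node `i` only
knows what can be made out of `u 0, …, u (k - 1)`. -/
theorem mem_reach_of_run (hG : G.Connected) (a : DistAlgorithm M) (s : Fin M) {τ : ℕ} {σ : ℝ}
    {L : Fin M → ℝ} {u : ℕ → EuclideanSpace ℝ (Fin S)}
    (hu : ∀ k ≤ T, ∀ t ≤ τ, ∀ x ∈ reach (a.ops S L τ) (Submodule.span ℝ (u '' Set.Iio k)) t,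
      inner ℝ (u k) x = 0)
    {x : ℕ → Fin M → EuclideanSpace ℝ (Fin S)} (hx0 : ∀ i, x 0 i = 0)
    (hx : ∀ t i, x (t + 1) i ∈ Submodule.span ℝ
      ({z | ∃ k ≤ t, ∃ j, G.Adj i j ∧ z = a.Wv S L t i k j (a.Q S L k j (x k j))} ∪
       {z | ∃ k ≤ t, z = a.Wg S L t i k (chainGrad T σ (L i) u (sideWeight G s D T i) (x k i))} ∪
       {z | ∃ k ≤ t, z = a.Wx S L t i k (x k i)}))
    (t : ℕ) (ht : t ≤ τ) (k : ℕ) (hk : k ≤ T) (i : Fin M)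
    (hlt : t < 1 + k * (D - 2 * (D / 3) + 1) + sideDist G s D k i) :
    x t i ∈ reach (a.ops S L τ) (Submodule.span ℝ (u '' Set.Iio k)) t := by
  induction t using Nat.strong_induction_on generalizing k i with
  | _ t ih =>
  cases t with
  | zero => rw [hx0]; exact Submodule.zero_mem _
  | succ t =>
  have hle : ∀ r ≤ t, ∀ j, r < 1 + k * (D - 2 * (D / 3) + 1) + sideDist G s D k j →
      x r j ∈ reach (a.ops S L τ) (Submodule.span ℝ (u '' Set.Iio k)) t := fun r hr j hj =>
    reach_mono_right _ hr (ih r (by omega) (by omega) k hk j hj)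
  refine (Submodule.span_le (p := reach (a.ops S L τ) _ (t + 1))).mpr ?_ (hx t i)
  rintro z ((⟨r, hr, j, hadj, rfl⟩ | ⟨r, hr, rfl⟩) | ⟨r, hr, rfl⟩)
  · have h1 := sideDist_le_add_one (D := D) hG s hadj k
    exact apply_mem_reach_succ (hle r hr j (by omega))
      ((⟨t, by omega⟩, i, ⟨r, by omega⟩, Sum.inl j) : Fin τ × Fin M × Fin τ × (Fin M ⊕ Bool))
  · refine apply_mem_reach_succ (ops := a.ops S L τ) ?_
      ((⟨t, by omega⟩, i, ⟨r, by omega⟩, Sum.inr true) : Fin τ × Fin M × Fin τ × (Fin M ⊕ Bool))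
    -- The gradient is a combination of the `u j` alone, so it lies in round `0` of `reach` no
    -- matter which operators built the iterate.
    refine reach_mono_right _ (Nat.zero_le t) (chainGrad_mem_span hk ?_ ?_)
    · intro j hkj hj
      refine hu j hj r (by omega) _ (reach_mono_left (Submodule.span_mono ?_) r
        (ih r (by omega) (by omega) k hk i (by omega)))
      exact Set.image_mono (Set.Iio_subset_Iio hkj)
    -- Only an owner of link `k` could reveal `u k`. It is at the full gap from the owners of link
    -- `k - 1`, so by induction its coordinate along `u (k - 1)` is still zero. For `k = 0`, `hlt`
    -- would read `t + 1 < 1`.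
    · by_cases hs : sideDist G s D k i = 0
      · right
        cases k with
        | zero => omega
        | succ k =>
          have h1 := sideDist_add_sideDist_succ (G := G) (D := D) s i k
          refine ⟨Nat.succ_pos k, hu k (by omega) r (by omega) _
            (ih r (by omega) (by omega) k (by omega) i ?_)⟩
          rw [Nat.add_mul] at hlt
          omega
      · exact Or.inl (sideWeight_of_ne_zero hs)
  · exact apply_mem_reach_succ (hle r hr i (by omega))
      ((⟨t, by omega⟩, i, ⟨r, by omega⟩, Sum.inr false) : Fin τ × Fin M × Fin τ × (Fin M ⊕ Bool))

end Progress

/-- The distance from consensus along the path is controlled by the edge differences. -/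
theorem IsGeodesic.norm_sub_le {E : Type*} [SeminormedAddCommGroup E] {M : ℕ}
    {G : SimpleGraph (Fin M)} {v : ℕ → Fin M} {D : ℕ} {l : ℝ} (hv : IsGeodesic G v D)
    (hG : G.Connected) (hl : 0 < l) (x : Fin M → E) {j : ℕ} (hj : j ≤ D) :
    l * ‖x (v j) - x (v 0)‖ ≤ D * Real.sqrt (l * ∑ e : GraphEdge G,
      Real.sqrt (pathLipschitz v D l e.1.1 * pathLipschitz v D l e.1.2)
        * ‖x e.1.1 - x e.1.2‖ ^ 2) := by
  rw [hv.sum_edge_eq hG (h := fun a b => Real.sqrt (pathLipschitz v D l a * pathLipschitz v D l b)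
      * ‖x a - x b‖ ^ 2)]
  · set Q := ∑ j ∈ Finset.range D, Real.sqrt (pathLipschitz v D l (v j)
      * pathLipschitz v D l (v (j + 1))) * ‖x (v j) - x (v (j + 1))‖ ^ 2 with hQ
    have hedge : ∀ i < D, l * ‖x (v i) - x (v (i + 1))‖ ≤ Real.sqrt (l * Q) := by
      intro i hi
      refine Real.le_sqrt_of_sq_le ?_
      have h1 := Finset.single_le_sum (f := fun j => Real.sqrt (pathLipschitz v D l (v j)
        * pathLipschitz v D l (v (j + 1))) * ‖x (v j) - x (v (j + 1))‖ ^ 2)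
        (fun j _ => by positivity) (Finset.mem_range.mpr hi)
      simp only [← hQ, pathLipschitz_apply hi.le, pathLipschitz_apply (Nat.succ_le_of_lt hi),
        Real.sqrt_mul_self hl.le] at h1
      have h2 := mul_le_mul_of_nonneg_left h1 hl.le
      rw [mul_pow]
      linarith
    have h1 := dist_le_Ico_sum_dist (fun i => x (v i)) (Nat.zero_le j)
    rw [dist_comm] at h1
    simp only [dist_eq_norm] at h1
    have h2 := mul_le_mul_of_nonneg_left h1 hl.le
    rw [Finset.mul_sum] at h2
    refine h2.trans ((Finset.sum_le_sum fun i hi => hedge i ?_).trans ?_)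
    · rw [Finset.mem_Ico] at hi; omega
    · rw [Finset.sum_const, Nat.card_Ico, nsmul_eq_mul, Nat.sub_zero]
      gcongr
  · intro a b
    rw [mul_comm (pathLipschitz v D l a), norm_sub_rev]
  · intro a b ha
    rw [pathLipschitz_of_notMem ha, zero_mul, Real.sqrt_zero, zero_mul]

/-! ### Size of the gradient while the chain is incomplete -/

section Stationarity

variable {E : Type*} [NormedAddCommGroup E] [InnerProductSpace ℝ E] {M : ℕ}
  {G : SimpleGraph (Fin M)} {v : ℕ → Fin M} {D T : ℕ} {σ l : ℝ} {u : ℕ → E}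

/-- At consensus, the gradient is large as long as the last coordinate of the chain vanishes. -/
theorem IsGeodesic.le_norm_sum_chainGrad (hv : IsGeodesic G v D) (hσ : 0 < σ) (hl : 0 < l)
    (ho : OrthonormalUpTo u (T + 1)) {z : E} (hz : inner ℝ (u T) z = 0) :
    (D / 3 + 1 : ℕ) * l * σ / 64 ≤ ‖∑ i, chainGrad (T + 1) σ (pathLipschitz v D l i) u
      (sideWeight G (v 0) D (T + 1) i) z‖ := by
  -- The chain starts at `1` and ends at `0`; the gradient is tested against `u j` where it drops
  -- below `1`.
  obtain ⟨j, hj, h1, h2⟩ := exists_one_le_and_lt_one (c := chainCoord σ u z) (T := T + 1)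
    (by simp [chainCoord]) (by simp [chainCoord, hz])
  refine le_trans ?_ (abs_inner_le_norm_of_orthonormalUpTo ho hj.le _)
  rw [inner_sum, Finset.sum_congr rfl fun i _ => inner_chainGrad ho z hj.le]
  set c := chainCoord σ u z with hc
  have h3 : ∑ i, chainGradCoeff (T + 1) σ (pathLipschitz v D l i) u
      (sideWeight G (v 0) D (T + 1) i) z j
      = σ / 64 * ((∑ i, pathLipschitz v D l i * sideWeight G (v 0) D (T + 1) i j)
          * linkSnd (c j) (c (j + 1))
        + (∑ i, pathLipschitz v D l i * sideWeight G (v 0) D (T + 1) i (j + 1))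
          * linkFst (c (j + 1)) (c (j + 2))) := by
    rw [Finset.sum_mul, Finset.sum_mul, ← Finset.sum_add_distrib, Finset.mul_sum]
    refine Finset.sum_congr rfl fun i _ => ?_
    simp only [chainGradCoeff, if_pos hj, chainPartial, ← hc]
    ring
  rw [h3, hv.sum_pathLipschitz_mul_sideWeight l hj]
  have h4 : 0 ≤ ∑ i, pathLipschitz v D l i * sideWeight G (v 0) D (T + 1) i (j + 1) :=
    Finset.sum_nonneg fun i _ => mul_nonneg (pathLipschitz_nonneg hl.le i) (sideWeight_nonneg _ _ _)
  have h5 := mul_nonpos_of_nonneg_of_nonpos h4 (linkFst_nonpos (c (j + 1)) (c (j + 2)))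
  have h6 := linkSnd_le_neg_one h1 h2.le
  have hm : (0 : ℝ) < (D / 3 + 1 : ℕ) * l := by positivity
  have h7 := mul_le_mul_of_nonneg_left h6 hm.le
  have h8 := mul_le_mul_of_nonneg_left (add_le_add h7 h5) (show 0 ≤ σ / 64 by positivity)
  refine le_trans ?_ (neg_le_abs _)
  linarith

/-- Away from consensus, the gradient is large up to the consensus error. -/
theorem IsGeodesic.le_norm_sum_chainGrad_add (hv : IsGeodesic G v D) (hG : G.Connected)
    (hσ : 0 < σ) (hl : 0 < l) (ho : OrthonormalUpTo u (T + 1)) {x : Fin M → E}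
    (hx : inner ℝ (u T) (x (v 0)) = 0) :
    (D / 3 + 1 : ℕ) * l * σ / 64 ≤ ‖∑ i, chainGrad (T + 1) σ (pathLipschitz v D l i) u
      (sideWeight G (v 0) D (T + 1) i) (x i)‖ + (D + 1) ^ 2 * Real.sqrt (l * ∑ e : GraphEdge G,
      Real.sqrt (pathLipschitz v D l e.1.1 * pathLipschitz v D l e.1.2)
        * ‖x e.1.1 - x e.1.2‖ ^ 2) := by
  set R := Real.sqrt (l * ∑ e : GraphEdge G,
      Real.sqrt (pathLipschitz v D l e.1.1 * pathLipschitz v D l e.1.2)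
        * ‖x e.1.1 - x e.1.2‖ ^ 2) with hR
  set g : Fin M → E → E := fun i => chainGrad (T + 1) σ (pathLipschitz v D l i) u
      (sideWeight G (v 0) D (T + 1) i) with hg
  have h1 : (D / 3 + 1 : ℕ) * l * σ / 64 ≤ ‖∑ i, g i (x (v 0))‖ :=
    hv.le_norm_sum_chainGrad hσ hl ho hx
  have h2 : ‖∑ i, g i (x i) - ∑ i, g i (x (v 0))‖ ≤ ∑ i, pathLipschitz v D l i
      * ‖x i - x (v 0)‖ := by
    rw [← Finset.sum_sub_distrib]
    refine (norm_sum_le _ _).trans (Finset.sum_le_sum fun i _ => ?_)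
    exact norm_chainGrad_sub_le hσ (pathLipschitz_nonneg hl.le i) ho (sideWeight_self _ _)
      (sideWeight_nonneg _ _) (sideWeight_le_one _ _) _ _
  have h3 : ∑ i, pathLipschitz v D l i * ‖x i - x (v 0)‖ ≤ (D + 1) * (D * R) := by
    rw [hv.sum_eq fun i hi => by rw [pathLipschitz_of_notMem hi, zero_mul]]
    have h4 : ∀ j ∈ Finset.range (D + 1), pathLipschitz v D l (v j) * ‖x (v j) - x (v 0)‖
        ≤ D * R := by
      intro j hj
      rw [Finset.mem_range, Nat.lt_succ_iff] at hj
      rw [pathLipschitz_apply hj]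
      exact hv.norm_sub_le hG hl x hj
    refine (Finset.sum_le_sum h4).trans (le_of_eq ?_)
    simp
  have h5 := norm_sub_norm_le (∑ i, g i (x (v 0))) (∑ i, g i (x i))
  rw [norm_sub_rev] at h5
  -- Rounds `(D + 1) * D` up to `(D + 1) ^ 2`.
  have h6 : 0 ≤ (D + 1) * R := mul_nonneg (by positivity) (Real.sqrt_nonneg _)
  linarith

end Stationarity

/-! ### The lower bound -/

/-- The choice of scales: a gradient of size `2 √ε` cannot be hidden by a consensus error. -/
theorem not_lt_of_scales {M lam ε l n A Q : ℝ} (hM : 0 < M) (hlam : 0 < lam) (hε : 0 < ε)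
    (hl : 0 < l) (hn : 0 < n) (hscale : n ^ 4 * l * lam = M) (hQ : 0 ≤ Q)
    (hbound : 2 * Real.sqrt ε * M ≤ A + n ^ 2 * Real.sqrt (l * Q)) :
    ¬ (A / M) ^ 2 + 1 / (M * lam) * Q < ε := by
  intro h
  have h1 : 0 ≤ 1 / (M * lam) * Q := by positivity
  have h2 : A / M < Real.sqrt ε := by
    refine Real.lt_sqrt_of_sq_lt (by linarith)
  have h3 : Q < ε * (M * lam) := by
    have : 1 / (M * lam) * Q < ε := by nlinarith [sq_nonneg (A / M)]
    rwa [one_div_mul_eq_div, div_lt_iff₀ (by positivity)] at this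
  have h4 : n ^ 2 * Real.sqrt (l * Q) ≤ M * Real.sqrt ε := by
    have h5 : Real.sqrt (l * Q) ≤ M * Real.sqrt ε / n ^ 2 := by
      refine Real.sqrt_le_iff.mpr ⟨by positivity, ?_⟩
      rw [div_pow, mul_pow, Real.sq_sqrt hε.le, le_div_iff₀ (by positivity)]
      calc l * Q * (n ^ 2) ^ 2 ≤ l * (ε * (M * lam)) * (n ^ 2) ^ 2 := by gcongr
        _ = n ^ 4 * l * lam * (ε * M) := by ring
        _ = M ^ 2 * ε := by rw [hscale]; ring
    rw [le_div_iff₀ (by positivity)] at h5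
    linarith
  rw [div_lt_iff₀ hM] at h2
  linarith

/-- The size of the instance in terms of the length `T` of the chain. -/
theorem floor_arg_bounds {X Δ β ε M l L m n T N : ℝ} (hM : 0 < M) (hε : 0 < ε) (hl : 0 < l)
    (hm : 0 < m) (hmn : m ≤ n) (hn : n ≤ 3 * m) (hN : 0 ≤ N) (hT : T = 17 * N + 2)
    (hβ : m * l * β = 256 * M * ε) (h1 : (4 * T - 2) * β ≤ Δ) (h2 : Δ ≤ (4 * T - 1) * β)
    (hL : L = n * l / M) (hX : X = Δ * L / (1650 * Real.pi ^ 2) * ε⁻¹) :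
    N ≤ X ∧ X ≤ (T - 1) / 2 := by
  have hpi1 : 9 ≤ Real.pi ^ 2 := by nlinarith [Real.pi_gt_three]
  have hpi2 : Real.pi ^ 2 ≤ 10 := by nlinarith [Real.pi_gt_three, Real.pi_lt_d2]
  have hβ' : β = 256 * M * ε / (m * l) := by field_simp; linarith
  have hβ0 : 0 < β := by rw [hβ']; positivity
  have hn0 : 0 < n := hm.trans_le hmn
  set r := n / m with hr
  have hr1 : 1 ≤ r := by rw [hr, le_div_iff₀ hm]; linarith
  have hr3 : r ≤ 3 := by rw [hr, div_le_iff₀ hm]; linarith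
  have hX' : X = Δ / β * (256 * r) / (1650 * Real.pi ^ 2) := by
    rw [hX, hL, hβ', hr]
    field_simp
  have hq1 : 4 * T - 2 ≤ Δ / β := by rwa [le_div_iff₀ hβ0]
  have hq2 : Δ / β ≤ 4 * T - 1 := by rwa [div_le_iff₀ hβ0]
  rw [hX']
  -- With `9 ≤ π² ≤ 10` and `1 ≤ r ≤ 3` the claims reduce to `16500 N ≤ 256 (4T - 2) = 17408 N +
  -- 1536`, the reason for the factor `17`, and to `768 (4T - 1) ≤ 7425 (T - 1)`, valid for `T ≥ 2`.
  constructor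
  · rw [le_div_iff₀ (by positivity)]
    have h3 : N * (1650 * Real.pi ^ 2) ≤ N * (1650 * 10) := by gcongr
    have h4 : (4 * T - 2) * (256 * 1) ≤ Δ / β * (256 * r) := by
      have : 0 ≤ 4 * T - 2 := by linarith
      gcongr
      linarith
    linarith
  · rw [div_le_iff₀ (by positivity)]
    have h3 : (T - 1) / 2 * (1650 * 9) ≤ (T - 1) / 2 * (1650 * Real.pi ^ 2) := by
      have : 0 ≤ T - 1 := by linarith
      gcongr
    have h4 : Δ / β * (256 * r) ≤ (4 * T - 1) * (256 * 3) := by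
      have : 0 ≤ 4 * T - 1 := by linarith
      gcongr
    linarith

/-- No run solves the hard instance before the end of the chain is reached. -/
theorem IsGeodesic.le_time_of_hStar_lt {M S D T : ℕ} {G : SimpleGraph (Fin M)} {v : ℕ → Fin M}
    {ε l σ : ℝ} {u : ℕ → EuclideanSpace ℝ (Fin S)} {a : DistAlgorithm M}
    (hv : IsGeodesic G v D) (hG : G.Connected) (hM : (0 : ℝ) < M) (hε : 0 < ε) (hl : 0 < l)
    (hσ : 0 < σ)
    (hscale : ((D : ℝ) + 1) ^ 4 * l
      * lambdaMinPos (sqrtDegMatrix G * graphLaplacian G * sqrtDegMatrix G) = M)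
    (hgrad : (D / 3 + 1 : ℕ) * l * σ = 128 * M * Real.sqrt ε) (ho : OrthonormalUpTo u (T + 1))
    (hu : ∀ k ≤ T + 1, ∀ t ≤ 1 + T * (D - 2 * (D / 3) + 1),
      ∀ x ∈ reach (a.ops S (pathLipschitz v D l) (1 + T * (D - 2 * (D / 3) + 1)))
        (Submodule.span ℝ (u '' Set.Iio k)) t, inner ℝ (u k) x = 0)
    {x : ℕ → Fin M → EuclideanSpace ℝ (Fin S)}
    (hx : a.IsRun G (chainProblem (T + 1) σ (pathLipschitz v D l) u
      (sideWeight G (v 0) D (T + 1)) hσ (pathLipschitz_nonneg hl.le) ho (sideWeight_self _)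
      (sideWeight_nonneg _) (sideWeight_le_one _)) x) {t : ℕ}
    (ht : (chainProblem (T + 1) σ (pathLipschitz v D l) u
      (sideWeight G (v 0) D (T + 1)) hσ (pathLipschitz_nonneg hl.le) ho (sideWeight_self _)
      (sideWeight_nonneg _) (sideWeight_le_one _)).hStar G x t < ε) :
    1 + T * (D - 2 * (D / 3) + 1) ≤ t := by
  have hlam : 0 < lambdaMinPos (sqrtDegMatrix G * graphLaplacian G * sqrtDegMatrix G) := by
    rw [← hscale] at hM
    exact (pos_iff_pos_of_mul_pos hM).mp (by positivity)
  by_contra hlt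
  obtain ⟨s, hs, hgap⟩ := (Finset.inf'_lt_iff _).mp ht
  rw [Finset.mem_range] at hs
  have hmem := mem_reach_of_run hG a (v 0) hu hx.1 (isRun_chainProblem hx) s (by omega) T
    (Nat.le_succ T) (v 0) (by omega)
  have hz : inner ℝ (u T) (x s (v 0)) = 0 := hu T (Nat.le_succ T) s (by omega) _ hmem
  have hbound := hv.le_norm_sum_chainGrad_add hG hσ hl ho hz
  rw [localGap_chainProblem] at hgap
  refine not_lt_of_scales hM hlam hε hl (by positivity) hscale
    (Finset.sum_nonneg fun e _ => by positivity) ?_ hgap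
  refine le_trans (le_of_eq ?_) hbound
  rw [hgrad]
  ring

theorem corollary3p2 (M D : ℕ) (hM : 2 ≤ M) (G : SimpleGraph (Fin M)) (hG : G.Connected)
    (hD : G.diam = D) (ε : ℝ) (hε : 0 < ε) (a : DistAlgorithm M) (N : ℕ) :
    ∃ p : DistProblem M,
      -- the nodes with positive Lipschitz constant form a path that realizes the diameter,
      -- and they have a common Lipschitz constant
      (∃ (ℓ : ℝ) (u v : Fin M) (w : G.Walk u v), 0 < ℓ ∧ w.length = D ∧ G.dist u v = D ∧
        ∀ i, (i ∈ w.support → p.L i = ℓ) ∧ (i ∉ w.support → p.L i = 0)) ∧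
      -- the instance is non-degenerate: the floor below can be made as large as desired
      (N : ℤ) ≤ ⌊(p.obj 0 - (⨅ x, p.obj x) + p.d0NormSq / M) * p.avgL
          / (1650 * Real.pi ^ 2) * ε⁻¹⌋ ∧
      ∀ x : ℕ → Fin M → EuclideanSpace ℝ (Fin p.S), a.IsRun G p x →
        ∀ t : ℕ, p.hStar G x t < ε →
          1 / (3 * Real.sqrt (spectralGap (hatLaplacian G p.L))) *
            (⌊(p.obj 0 - (⨅ x, p.obj x) + p.d0NormSq / M) * p.avgL
              / (1650 * Real.pi ^ 2) * ε⁻¹⌋ : ℝ) ≤ (t : ℝ) := by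
  have hM0 : (0 : ℝ) < M := by exact_mod_cast (by omega : 0 < M)
  have : Nonempty (Fin M) := ⟨⟨0, by omega⟩⟩
  have : Nontrivial (Fin M) := Fin.nontrivial_iff_two_le.mpr hM
  -- a shortest path that realizes the diameter
  obtain ⟨b, c, hbc⟩ := G.exists_dist_eq_diam
  rw [hD] at hbc
  obtain ⟨w, hw⟩ := hG.exists_walk_length_eq_dist b c
  have hv := isGeodesic_getVert hG w hw
  rw [hw, hbc] at hv
  set v := w.getVert with hvdef
  -- scales
  obtain ⟨j, hj⟩ := hG.preconnected.exists_adj_of_nontrivial b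
  set lam := lambdaMinPos (sqrtDegMatrix G * graphLaplacian G * sqrtDegMatrix G) with hlamdef
  have hlam : 0 < lam := lambdaMinPos_laplacian_pos hj
  set n : ℝ := (D : ℝ) + 1 with hndef
  set m : ℝ := ((D / 3 + 1 : ℕ) : ℝ) with hmdef
  have hn0 : 0 < n := by positivity
  have hm0 : 0 < m := by positivity
  -- Solves `n ^ 4 * l * lam = M`, the balance required by `not_lt_of_scales`.
  set l : ℝ := M / (n ^ 4 * lam) with hldef
  have hl : 0 < l := by positivity
  -- Makes the gradient bound `m * l * σ / 64` equal to `2 * M * √ε`.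
  set σ : ℝ := 128 * M * Real.sqrt ε / (m * l) with hσdef
  have hσ : 0 < σ := by have := Real.sqrt_pos.mpr hε; positivity
  -- the dimension and the directions
  set T : ℕ := 17 * N + 1 with hTdef
  set d := D - 2 * (D / 3) with hddef
  set τ : ℕ := 1 + T * (d + 1) with hτdef
  -- Both `S` and `L` are fixed before `u`, so the operators are known when the directions are
  -- chosen.
  set S : ℕ := (1 + Fintype.card (Fin τ × Fin M × Fin τ × (Fin M ⊕ Bool))) ^ τ * (T + 1 + 1) + 1
    with hSdef
  set L := pathLipschitz v D l with hLdef
  obtain ⟨u, ho, hu⟩ := exists_orthonormal_out_of_reach (E := EuclideanSpace ℝ (Fin S)) (T + 1) τ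
    (by rw [finrank_euclideanSpace_fin]; omega) (a.ops S L τ)
  set α := sideWeight G (v 0) D (T + 1) with hα
  set p := chainProblem (T + 1) σ L u α hσ (pathLipschitz_nonneg hl.le) ho (sideWeight_self _)
    (sideWeight_nonneg _) (sideWeight_le_one _) with hp
  -- the size of the instance
  set Δ := p.obj 0 - (⨅ x, p.obj x) + p.d0NormSq / M with hΔ
  -- Unit of the objective: one link contributes at most `4 * β` to its decrease.
  set β := m * l * σ ^ 2 / (64 * M) with hβdef
  have hsum : ∀ k < T + 1, ∑ i, L i * α i k = m * l := fun k hk =>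
    hv.sum_pathLipschitz_mul_sideWeight l hk
  have hobj0 : p.obj 0 = -(2 * β) := by
    rw [hp, obj_chainProblem_zero (Nat.succ_pos T)]
    have h1 : ∑ i, -(2 * (L i * σ ^ 2 / 64) * α i 0) = -(σ ^ 2 / 32) * ∑ i, L i * α i 0 := by
      rw [Finset.mul_sum]
      exact Finset.sum_congr rfl fun i _ => by ring
    rw [h1, hsum 0 (Nat.succ_pos T), hβdef]
    field_simp
    norm_num
  have hinf : ⨅ x, p.obj x = -(4 * (T + 1 : ℕ) * β) := by
    rw [hp, iInf_obj_chainProblem]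
    have h1 : ∑ i, -(4 * (L i * σ ^ 2 / 64) * ∑ k ∈ Finset.range (T + 1), α i k)
        = -(σ ^ 2 / 16) * ∑ k ∈ Finset.range (T + 1), ∑ i, L i * α i k := by
      rw [Finset.sum_comm, Finset.mul_sum]
      refine Finset.sum_congr rfl fun i _ => ?_
      rw [← Finset.mul_sum]
      ring
    rw [h1, Finset.sum_congr rfl fun k hk => hsum k (Finset.mem_range.mp hk), Finset.sum_const,
      Finset.card_range, nsmul_eq_mul, hβdef]
    field_simp
    norm_num
  have hd0 : 0 ≤ p.d0NormSq / M := div_nonneg d0NormSq_chainProblem_nonneg hM0.le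
  have hd1 : p.d0NormSq / M ≤ β := by
    have h1 : p.d0NormSq ≤ σ ^ 2 / 1024 * ∑ i, L i * α i 0 :=
      d0NormSq_chainProblem_le (Nat.succ_pos T) fun i => sideWeight_sq _ _ _
    rw [hsum 0 (Nat.succ_pos T)] at h1
    rw [div_le_iff₀ hM0, hβdef]
    refine h1.trans ?_
    have h2 : m * l * σ ^ 2 / (64 * M) * M = m * l * σ ^ 2 / 64 := by field_simp
    have h3 : 0 < m * l * σ ^ 2 := by positivity
    rw [h2]
    linarith
  have hβ : m * l * β = 256 * M * ε := by
    rw [hβdef, hσdef]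
    field_simp
    rw [Real.sq_sqrt hε.le]
    norm_num
  have havg : p.avgL = n * l / M := by
    have h1 : p.avgL = (1 / (M : ℝ)) * ∑ i, L i := rfl
    rw [h1, hLdef, hv.sum_pathLipschitz]
    ring
  have hmn : m ≤ n := by
    rw [hmdef, hndef]
    exact_mod_cast (by omega : D / 3 + 1 ≤ D + 1)
  have hn3 : n ≤ 3 * m := by
    rw [hmdef, hndef]
    exact_mod_cast (by omega : D + 1 ≤ 3 * (D / 3 + 1))
  obtain ⟨hX1, hX2⟩ := floor_arg_bounds (T := (T + 1 : ℕ)) (N := N) hM0 hε hl hm0 hmn hn3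
    (Nat.cast_nonneg N) (by rw [hTdef]; push_cast; ring) hβ (Δ := Δ)
    (by rw [hΔ, hobj0, hinf]; linarith) (by rw [hΔ, hobj0, hinf]; linarith) havg rfl
  refine ⟨p, ⟨l, b, c, w, hl, hw.trans hbc, hbc, fun i => ?_⟩, ?_, ?_⟩
  · have hiff : i ∈ w.support ↔ ∃ j ≤ D, v j = i := by
      rw [SimpleGraph.Walk.mem_support_iff_exists_getVert, hw, hbc]
      exact ⟨fun ⟨j, h1, h2⟩ => ⟨j, h2, h1⟩, fun ⟨j, h1, h2⟩ => ⟨j, h2, h1⟩⟩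
    rw [hiff]
    exact ⟨pathLipschitz_of_mem, pathLipschitz_of_notMem⟩
  · exact Int.le_floor.mpr (by exact_mod_cast hX1)
  intro x hx t ht
  have hτt : τ ≤ t := hv.le_time_of_hStar_lt hG hM0 hε hl hσ (by rw [← hlamdef, ← hndef, hldef]; field_simp)
    (by rw [← hmdef, hσdef]; field_simp) ho hu hx ht
  have hτ : n * T / 3 ≤ τ := by
    have h1 : D + 1 ≤ 3 * (d + 1) := by omega
    have h2 : (D + 1) * T ≤ 3 * τ := by
      rw [hτdef]
      nlinarith [Nat.mul_le_mul_right T h1]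
    have h3 : n * T ≤ 3 * τ := by rw [hndef]; exact_mod_cast h2
    linarith
  have hxi := hv.one_div_sqrt_spectralGap_le hG hl
  set F := ⌊Δ * p.avgL / (1650 * Real.pi ^ 2) * ε⁻¹⌋ with hF
  have hF0 : (0 : ℝ) ≤ F := by
    have h1 : (0 : ℤ) ≤ F := Int.le_floor.mpr (by
      push_cast; exact (Nat.cast_nonneg N).trans hX1)
    exact_mod_cast h1
  have hFT : (F : ℝ) ≤ T / 2 := by
    refine (Int.floor_le _).trans (hX2.trans (le_of_eq ?_))
    push_cast
    ring
  have hsplit : 1 / (3 * Real.sqrt (spectralGap (hatLaplacian G p.L)))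
      = 1 / 3 * (1 / Real.sqrt (spectralGap (hatLaplacian G L))) := by
    rw [one_div_mul_one_div]
    rfl
  rw [hsplit]
  -- The spectral bound `2 * n` and the floor bound `T / 2` multiply to exactly the delay of `n / 3`
  -- per link.
  calc 1 / 3 * (1 / Real.sqrt (spectralGap (hatLaplacian G L))) * (F : ℝ)
      ≤ 1 / 3 * (2 * n) * (T / 2) := by gcongr
    _ = n * T / 3 := by ring
    _ ≤ τ := hτ
    _ ≤ t := by exact_mod_cast hτt
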